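/- Let $\mathcal{M}$ be a countably infinite structure in a countable first-order language $\mathcal{L}$, and suppose that $\mathcal{M}$ is $\aleph_0$-categorical, i.e. any two countably infinite models of $\mathrm{Th}(\mathcal{M})$ are isomorphic. "Definable" means definable with parameters unless a parameter set is specified; $\mathsf{Def}(\mathcal{M})$ is the collection of all definable sets $X\subseteq M^n$, $n\ge 1$; $\phi(\mathcal{M},\bar a)=\{\bar x:\mathcal{M}\models\phi(\bar x,\bar a)\}$. For a tuple $\bar a\in M^n$ ($n\geq 1$) and a finite $C\subseteq M$ we identify $\mathrm{tp}(\bar a/C)$ with its solution set in $M^n$ (which is definable over $C$, since by $\aleph_0$-categoricity the type is isolated), and for a function $h=(\dim,\mathrm{meas})$ on $\mathsf{Def}(\mathcal{M})$ we write $h(\bar a/C)=(\dim(\bar a/C),\mathrm{meas}(\bar a/C))$ for the value of $h$ at that set. $\mathcal{M}$ is called *MS-measurable* if there is a function $h=(\dim,\mathrm{meas}):\mathsf{Def}(\mathcal{M})\to(\mathbb{N}\times\mathbb{R}^{>0})\cup\{(0,0)\}$ such that: * (MS1) for each $\mathcal{L}$-formula $\phi(\bar x,\bar y)$, with $\bar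 y$ of length $m$, the set of values $\{h(\phi(\mathcal{M},\bar a)):\bar a\in M^m\}$ is finite; * (MS2) if $\phi(\mathcal{M},\bar a)$ is finite, then $h(\phi(\mathcal{M},\bar a))=(0,|\phi(\mathcal{M},\bar a)|)$; * (MS3) for each $\mathcal{L}$-formula $\phi(\bar x,\bar y)$ and each value $(d,\mu)$, the set $\{\bar a\in M^m:h(\phi(\mathcal{M},\bar a))=(d,\mu)\}$ is $\emptyset$-definable; * (MS4) if $f:X\to Y$ is a definable surjection between sets in $\mathsf{Def}(\mathcal{M})$, $D=\{h(f^{-1}[\bar b]):\bar b\in Y\}$ (a finite set), and $Y(d,\mu)=\{\bar b\in Y:h(f^{-1}[\bar b])=(d,\mu)\}$ (a definable set) for $(d,\mu)\in D$, then $$\dim(X)=\max_{(d,\mu)\in D}\bigl(d+\dim Y(d,\mu)\bigr),\qquad \mathrm{meas}(X)=\sum_{\substack{(d,\mu)\in D\\ d+\dim Y(d,\mu)=\dim X}}\mu\cdot\mathrm{meas}\,Y(d,\mu).$$ Then the following are equivalent. 1. $\mathcal{M}$ is MS-measurable. 2. There is a function $h=(\dim,\mathrm{meas}):\mathsf{Def}(\mathcal{M})\to(\mathbb{N}\times\mathbb{R}^{>0})\cup\{(0,0)\}$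 such that, for every finite $C\subseteq M$ and all $n,m\ge 1$: * (cMS1) $h(g\bar a/gC)=h(\bar a/C)$ for all $\bar a\in M^n$ and $g\in\mathrm{Aut}(\mathcal{M})$; * (cMS2) if $X\subseteq M^n$ is $C$-definable and is the disjoint union of (the solution sets of) $\mathrm{tp}(\bar a_0/C),\dots,\mathrm{tp}(\bar a_{k-1}/C)$, then $\dim(X)=\max_{i<k}\dim(\bar a_i/C)$ and $\mathrm{meas}(X)=\sum\mathrm{meas}(\bar a_i/C)$, the sum being over those $i<k$ with $\dim(\bar a_i/C)=\dim(X)$; * (cMS3) if $\bar a\in\mathrm{acl}(C)^n$, then $\dim(\bar a/C)=0$ and $\mathrm{meas}(\bar a/C)=|\{g\bar a:g\in\mathrm{Aut}(\mathcal{M}/C)\}|$, where $\mathrm{Aut}(\mathcal{M}/C)$ is the group of automorphisms fixing $C$ pointwise; * (cMS4) if $\bar a\in M^n$, $\bar b\in M^m$ and all coordinates of $\bar b$ lie in $\mathrm{dcl}(C\bar a)$, then $\dim(\bar a/C)=\dim(\bar b/C)+\dim(\bar a/C\bar b)$ and $\mathrm{meas}(\bar a/C)=\mathrm{meas}(\bar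 b/C)\cdot\mathrm{meas}(\bar a/C\bar b)$. (Maxima and sums over the empty index set are $0$.) -/

import Mathlib

open FirstOrder Cardinal

universe u v w

noncomputable section

namespace MSMeasure

/-- The set of values `(ℕ × ℝ^{>0}) ∪ {(0,0)}`. -/
def Value : Type := {p : ℕ × ℝ // 0 < p.2 ∨ p = (0, 0)}

variable (L : FirstOrder.Language.{u, v}) (M : Type w) [L.Structure M]

/-- Functions `h = (dim, meas) : Def(M) → (ℕ × ℝ^{>0}) ∪ {(0,0)}`, where `Def(M)` is the collection
of all sets `X ⊆ M^k` (`k ≥ 1`, written `k = n + 1`) that are definable in `M` with parameters. -/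
def ValueFunction : Type w :=
  (n : ℕ) → L.DefinableSet (Set.univ : Set M) (Fin (n + 1)) → Value

variable {L M}

open Classical in
/-- The value `h(X) = (dim X, meas X)` of a definable set `X`. (A set that is not definable gets
the irrelevant value `(0,0)`; below, `h` is only evaluated at definable sets.) -/
def ValueFunction.val (h : ValueFunction L M) {n : ℕ} (X : Set (Fin (n + 1) → M)) : ℕ × ℝ :=
  if hX : (Set.univ : Set M).Definable L X then (h n ⟨X, hX⟩).1 else (0, 0)

/-- `dim X`. -/
def ValueFunction.dim (h : ValueFunction L M) {n : ℕ} (X : Set (Fin (n + 1) → M)) : ℕ :=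
  (h.val X).1

/-- `meas X`. -/
def ValueFunction.meas (h : ValueFunction L M) {n : ℕ} (X : Set (Fin (n + 1) → M)) : ℝ :=
  (h.val X).2

/-- The set `φ(M, a)` defined by the formula `φ(x, y)` with the tuple `a` substituted for `y`. -/
def solutionSet {n m : ℕ} (φ : L.Formula (Fin n ⊕ Fin m)) (a : Fin m → M) :
    Set (Fin n → M) :=
  {x | φ.Realize (Sum.elim x a)}

/-- `f` restricts to a definable surjective function from `X` onto `Y`: its image on `X` is `Y`, and
its graph over `X` is definable with parameters. (Only the values of `f` on `X` matter.) -/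
def IsDefinableSurjection (L : FirstOrder.Language.{u, v}) [L.Structure M] {n m : ℕ}
    (X : Set (Fin n → M)) (Y : Set (Fin m → M)) (f : (Fin n → M) → (Fin m → M)) : Prop :=
  f '' X = Y ∧
    (Set.univ : Set M).Definable L
      {z : Fin n ⊕ Fin m → M | z ∘ Sum.inl ∈ X ∧ f (z ∘ Sum.inl) = z ∘ Sum.inr}

/-- The fibre over `b` of the function `f` restricted to `X`. -/
def fibre {n m : ℕ} (X : Set (Fin n → M)) (f : (Fin n → M) → (Fin m → M)) (b : Fin m → M) :
    Set (Fin n → M) :=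
  {x ∈ X | f x = b}

/-- `Y(d, μ)`: the set of points of `Y` over which the fibre of `f : X → Y` has value `(d, μ)`. -/
def ValueFunction.level (h : ValueFunction L M) {n m : ℕ} (X : Set (Fin (n + 1) → M))
    (Y : Set (Fin (m + 1) → M)) (f : (Fin (n + 1) → M) → (Fin (m + 1) → M)) (v : ℕ × ℝ) :
    Set (Fin (m + 1) → M) :=
  {b ∈ Y | h.val (fibre X f b) = v}

/-- The conditions MS1--MS4 on `h = (dim, meas)`. -/
structure IsMS (h : ValueFunction L M) : Prop where
  /-- Each formula `φ(x, y)` gives only finitely many values `h(φ(M, a))`. -/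
  ms1 : ∀ (n m : ℕ) (φ : L.Formula (Fin (n + 1) ⊕ Fin m)),
    ∃ D : Set (ℕ × ℝ), D.Finite ∧ ∀ a : Fin m → M, h.val (solutionSet φ a) ∈ D
  /-- A finite definable set has dimension `0` and measure its cardinality. -/
  ms2 : ∀ (n m : ℕ) (φ : L.Formula (Fin (n + 1) ⊕ Fin m)) (a : Fin m → M),
    (solutionSet φ a).Finite → h.val (solutionSet φ a) = (0, ((solutionSet φ a).ncard : ℝ))
  /-- The set of parameters at which a given value is taken is definable without parameters.
  (For a value that is not taken this set is empty, hence definable.) -/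
  ms3 : ∀ (n m : ℕ) (φ : L.Formula (Fin (n + 1) ⊕ Fin m)) (v : ℕ × ℝ),
    (∅ : Set M).Definable L {a : Fin m → M | h.val (solutionSet φ a) = v}
  /-- Fubini. The set `D` of values of `h` on the fibres is finite, each `Y(d, μ)` is definable,
  and `dim X`, `meas X` are computed from the `Y(d, μ)`. (As `D` is exactly the set of values on
  fibres, the sets `Y(d, μ)` with `(d, μ) ∈ D` form a partition of `Y`.) -/
  ms4 : ∀ (n m : ℕ) (X : Set (Fin (n + 1) → M)) (Y : Set (Fin (m + 1) → M))
    (f : (Fin (n + 1) → M) → (Fin (m + 1) → M)),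
    (Set.univ : Set M).Definable L X → (Set.univ : Set M).Definable L Y →
    IsDefinableSurjection L X Y f →
    ∃ D : Finset (ℕ × ℝ),
      (D : Set (ℕ × ℝ)) = (fun b => h.val (fibre X f b)) '' Y ∧
      (∀ v ∈ D, (Set.univ : Set M).Definable L (h.level X Y f v)) ∧
      h.dim X = D.sup (fun v => v.1 + h.dim (h.level X Y f v)) ∧
      h.meas X = ∑ v ∈ D with v.1 + h.dim (h.level X Y f v) = h.dim X,
        v.2 * h.meas (h.level X Y f v)

variable (L M) in
/-- `M` is an MS-measurable structure. -/
def IsMSMeasurable : Prop :=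
  Infinite M ∧ ∃ h : ValueFunction L M, IsMS h

variable (L) in
/-- The solution set of `tp(a/C)`: all tuples satisfying the same formulas over `C` as `a`. -/
def typeSet {n : ℕ} (C : Set M) (a : Fin n → M) : Set (Fin n → M) :=
  {a' | ∀ φ : L[[C]].Formula (Fin n), φ.Realize a' ↔ φ.Realize a}

variable (L) in
/-- The algebraic closure of `C`: the union of the finite `C`-definable subsets of `M`. -/
def acl (C : Set M) : Set M :=
  {d | ∃ S : Set M, S.Finite ∧ C.Definable₁ L S ∧ d ∈ S}

variable (L) in
/-- The definable closure of `C`: the elements `d` such that `{d}` is `C`-definable. -/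
def dcl (C : Set M) : Set M :=
  {d | C.Definable₁ L {d}}

variable (L) in
/-- The orbit of the tuple `a` under `Aut(M/C)`. -/
def orbitOver {n : ℕ} (C : Set M) (a : Fin n → M) : Set (Fin n → M) :=
  {a' | ∃ g : M ≃[L] M, (∀ c ∈ C, g c = c) ∧ a' = g ∘ a}

/-- The conditions cMS1--cMS4 on `h = (dim, meas)`; `h(a/C)` is `h` of the solution set of
`tp(a/C)`. -/
structure IsCMS (h : ValueFunction L M) : Prop where
  cms1 : ∀ (n : ℕ) (C : Set M) (a : Fin (n + 1) → M) (g : M ≃[L] M), C.Finite →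
    h.val (typeSet L (g '' C) (g ∘ a)) = h.val (typeSet L C a)
  /-- For `k = 0`, that is `X = ∅`, the maximum and the sum are `0`. -/
  cms2 : ∀ (n : ℕ) (C : Set M) (X : Set (Fin (n + 1) → M)) (k : ℕ)
    (a : Fin k → Fin (n + 1) → M), C.Finite → C.Definable L X →
    X = ⋃ i, typeSet L C (a i) →
    Pairwise (fun i j => Disjoint (typeSet L C (a i)) (typeSet L C (a j))) →
    h.dim X = Finset.univ.sup (fun i => h.dim (typeSet L C (a i))) ∧
    h.meas X = ∑ i with h.dim (typeSet L C (a i)) = h.dim X, h.meas (typeSet L C (a i))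
  cms3 : ∀ (n : ℕ) (C : Set M) (a : Fin (n + 1) → M), C.Finite → (∀ i, a i ∈ acl L C) →
    h.dim (typeSet L C a) = 0 ∧ h.meas (typeSet L C a) = ((orbitOver L C a).ncard : ℝ)
  cms4 : ∀ (n m : ℕ) (C : Set M) (a : Fin (n + 1) → M) (b : Fin (m + 1) → M), C.Finite →
    (∀ i, b i ∈ dcl L (C ∪ Set.range a)) →
    h.dim (typeSet L C a) =
      h.dim (typeSet L C b) + h.dim (typeSet L (C ∪ Set.range b) a) ∧
    h.meas (typeSet L C a) =
      h.meas (typeSet L C b) * h.meas (typeSet L (C ∪ Set.range b) a)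

end MSMeasure

end

/-! Both axiom systems are compared through the orbits of tuples under `Aut(M/C)`, with `C` finite.
By the Ryll-Nardzewski facts, derived here from categoricity, these orbits are the solution sets of
types over `C`, each power of `M` has finitely many of them, and a set is `C`-definable exactly when
`Aut(M/C)` preserves it (`typeSet_eq_orbitOver`, `finite_orbitOver`, `definable_iff_invariant`). The
core is that every finite tuple has an isolated type (`isolated`): a generic construction inside `M`
yields an elementary substructure whose tuples are all isolated, and categoricity identifies it with
`M`. Back-and-forth then gives homogeneity.

A value `(d, μ)` behaves like a leading term `μ T ^ d`: values of disjoint pieces add (`leadingSum`)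
and values along a fibration multiply (`leadingMul`). The same `h` serves in both directions.

From MS to cMS: MS3 forces invariance under automorphisms, additivity is Fubini for a map onto
finitely many points, and cMS4 is Fubini for `g a ↦ g b`, whose fibres are translates of one
another.

From cMS to MS: a definable set is a finite union of orbits over some finite `C`, so cMS2 computes
its value. For a `C`-definable surjection `f`, cMS4 writes the value of the orbit of `a` as that of
the orbit of `f a` times that of the orbit of `a` over `C` and `f a`. Grouping the orbits of the
domain by image orbit, and these by fibre value, gives MS4 (`IsCMS.fubini`). -/

noncomputable section

namespace MSMeasure

open FirstOrder.Language

/-! ### Realising types in a categorical structure -/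

section

variable {L : FirstOrder.Language.{u, v}} {M : Type w} [L.Structure M]

/-- Every type of a finite tuple in a model of `Th(M)` is realised in `M`. -/
theorem exists_realize_iff_of_elementarilyEquivalent [Countable L.Symbols] [Countable M] [Infinite M]
    (hM : Cardinal.Categorical (ℵ₀ : Cardinal.{w}) (L.completeTheory M))
    {N : Type*} [L.Structure N] (hN : M ≅[L] N) {α : Type*} [Finite α] (v : α → N) :
    ∃ a : α → M, ∀ φ : L.Formula α, φ.Realize a ↔ φ.Realize v := by
  have : Infinite N := hN.infinite
  obtain ⟨S, hvS, hS⟩ := exists_elementarySubstructure_card_eq L (Set.range v) (ℵ₀ : Cardinal.{w})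
    le_rfl (by
      simp only [lift_aleph0, lift_le_aleph0]
      exact (Set.finite_range v).lt_aleph0.le) (by
      simp only [lift_aleph0, lift_le_aleph0]
      exact mk_le_aleph0_iff.2 ‹Countable L.Symbols›) (by
      simp only [lift_aleph0, aleph0_le_lift]
      exact aleph0_le_mk N)
  -- Categoricity speaks of structures in the universe `w`, so the countable `S` is replaced by a
  -- copy `B` living there.
  have : Small.{w} S := by
    rw [← lift_inj.{_, w + 1}, lift_lift, lift_lift] at hS
    exact small_iff_lift_mk_lt_univ.2 (lt_of_eq_of_lt hS (ℵ₀ : Cardinal.{w}).lift_lt_univ')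
  let B := (equivShrink S).bundledInduced L
  let e : S ≃[L] B := Equiv.bundledInducedEquiv L _
  have hB : #B = ℵ₀ := lift_inj.1 (by
    refine Eq.trans ?_ hS
    simp only [B, Equiv.bundledInduced_α, lift_mk_shrink'])
  have hSM : M ≅[L] B :=
    hN.trans (S.elementarilyEquivalent.symm.trans e.toElementaryEmbedding.elementarilyEquivalent)
  have : Nonempty B := hSM.nonempty
  have hBM : B ⊨ L.completeTheory M := hSM.theory_model
  obtain ⟨g⟩ := hM ⟨B⟩ ⟨M⟩ hB (mk_eq_aleph0 M)
  let f : S ≃[L] M := g.comp e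
  have hv : ∀ i, v i ∈ S := fun i => hvS ⟨i, rfl⟩
  refine ⟨fun i => f ⟨v i, hv i⟩, fun φ => ?_⟩
  have h1 := f.toElementaryEmbedding.map_formula φ (fun i => ⟨v i, hv i⟩)
  have h2 := S.subtype.map_formula φ (fun i => ⟨v i, hv i⟩)
  exact h1.trans h2.symm

/-- A set of formulas in finitely many variables that is finitely satisfiable in `M` is realised
in `M`. -/
theorem exists_realize_of_finitely_realize [Countable L.Symbols] [Countable M] [Infinite M]
    (hM : Cardinal.Categorical (ℵ₀ : Cardinal.{w}) (L.completeTheory M))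
    {α : Type*} [Finite α] (Φ : Set (L.Formula α))
    (hΦ : ∀ s : Finset (L.Formula α), ↑s ⊆ Φ → ∃ a : α → M, ∀ φ ∈ s, φ.Realize a) :
    ∃ a : α → M, ∀ φ ∈ Φ, φ.Realize a := by
  classical
  -- Compactness, with the variables turned into new constants: a model of `Γ` is elementarily
  -- equivalent to `M` and realises `Φ`, and the previous lemma brings that type back into `M`.
  let Γ : L[[α]].Theory := (L.lhomWithConstants α).onTheory (L.completeTheory M) ∪
    Formula.equivSentence '' Φ
  have hΓ : Γ.IsSatisfiable := by
    rw [Theory.isSatisfiable_iff_isFinitelySatisfiable]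
    intro T₀ hT₀
    obtain ⟨a, ha⟩ := hΦ ((T₀.image Formula.equivSentence.symm).filter (· ∈ Φ))
      (by simp +contextual [Set.subset_def])
    let : (constantsOn α).Structure M := constantsOn.structure a
    have hM₀ : M ⊨ (L.lhomWithConstants α).onTheory (L.completeTheory M) :=
      (LHom.onTheory_model _ _).2 inferInstance
    have : M ⊨ (T₀ : L[[α]].Theory) := by
      refine Theory.model_iff _ |>.2 fun φ hφ => ?_
      rcases hT₀ hφ with h | ⟨ψ, hψ, rfl⟩
      · exact hM₀.realize_of_mem _ h
      · rw [Formula.realize_equivSentence]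
        refine ha ψ (Finset.mem_filter.2 ⟨Finset.mem_image.2 ⟨_, hφ, ?_⟩, hψ⟩)
        simp
    exact Theory.Model.isSatisfiable M
  obtain ⟨N⟩ := hΓ
  let N' := (N.subtheoryModel (Set.subset_union_left :
    (L.lhomWithConstants α).onTheory (L.completeTheory M) ⊆ Γ)).reduct (L.lhomWithConstants α)
  have hN' : M ≅[L] N' := by
    exact (completeTheory.isComplete L M).models_elementarily_equivalent M N'
  obtain ⟨a, ha⟩ := exists_realize_iff_of_elementarilyEquivalent hM hN'
    (fun i : α => (L.con i : N))
  refine ⟨a, fun φ hφ => (ha φ).2 ?_⟩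
  have h1 : N ⊨ Formula.equivSentence φ := N.is_model.realize_of_mem _ (Or.inr ⟨φ, hφ, rfl⟩)
  exact (@Formula.realize_equivSentence L N N'.struc α N.struc
    (LHom.isExpansionOn_reduct (L.lhomWithConstants α) N) φ).1 h1

end

/-! ### Isolated types -/

section

variable {L : FirstOrder.Language.{u, v}} {M : Type w} [L.Structure M]

variable (L) in
/-- The tuple `a` has an isolated type: some `∅`-definable set containing `a` is contained in every
`∅`-definable set containing `a`. -/
def Isolated {α : Type*} (a : α → M) : Prop :=
  ∃ S : Set (α → M), (∅ : Set M).Definable L S ∧ a ∈ S ∧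
    ∀ T : Set (α → M), (∅ : Set M).Definable L T → a ∈ T → S ⊆ T

variable (L) in
/-- The tuples `a` and `b` satisfy the same formulas. -/
def SameType {α : Type*} (a b : α → M) : Prop :=
  ∀ S : Set (α → M), (∅ : Set M).Definable L S → (a ∈ S ↔ b ∈ S)

theorem SameType.symm {α : Type*} {a b : α → M} (h : SameType L a b) : SameType L b a :=
  fun S hS => (h S hS).symm

theorem SameType.comp {α β : Type*} {a b : β → M} (h : SameType L a b) (f : α → β) :
    SameType L (a ∘ f) (b ∘ f) :=
  fun _ hS => h _ (hS.preimage_comp f)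

theorem sameType_of_mem {α : Type*} {a b : α → M} {S : Set (α → M)}
    (h : ∀ T : Set (α → M), (∅ : Set M).Definable L T → a ∈ T → S ⊆ T) (hb : b ∈ S) :
    SameType L a b := by
  refine fun T hT => ⟨fun ha => h T hT ha hb, fun hbT => ?_⟩
  by_contra ha
  exact h _ hT.compl ha hb hbT

theorem Isolated.comp {α β : Type*} [Finite α] [Finite β] {a : β → M} (h : Isolated L a)
    (f : α → β) : Isolated L (a ∘ f) := by
  obtain ⟨S, hS, haS, hmin⟩ := h
  refine ⟨_, hS.image_comp f, ⟨a, haS, rfl⟩, fun T hT haT => ?_⟩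
  rw [Set.image_subset_iff]
  exact hmin _ (hT.preimage_comp f) haT

theorem Isolated.of_elementaryEmbedding {α : Type*} (f : M ↪ₑ[L] M) {a : α → M}
    (h : Isolated L (f ∘ a)) : Isolated L a := by
  obtain ⟨S, hS, haS, hmin⟩ := h
  refine ⟨S, hS, ?_, fun T hT haT => hmin T hT ?_⟩
  · obtain ⟨φ, rfl⟩ := Set.empty_definable_iff.1 hS
    exact (f.map_formula φ a).1 haS
  · obtain ⟨φ, rfl⟩ := Set.empty_definable_iff.1 hT
    exact (f.map_formula φ a).2 haT

/-- A decreasing sequence of nonempty `∅`-definable sets of tuples has a common element. -/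
theorem exists_mem_iInter_of_antitone [Countable L.Symbols] [Countable M] [Infinite M]
    (hM : Cardinal.Categorical (ℵ₀ : Cardinal.{w}) (L.completeTheory M))
    {α : Type*} [Finite α] (T : ℕ → Set (α → M)) (hT : Antitone T)
    (hdef : ∀ k, (∅ : Set M).Definable L (T k)) (hne : ∀ k, (T k).Nonempty) :
    ∃ a, ∀ k, a ∈ T k := by
  choose φ hφ using fun k => Set.empty_definable_iff.1 (hdef k)
  obtain ⟨a, ha⟩ := exists_realize_of_finitely_realize hM (Set.range φ) fun s hs => by
    have : ∃ k, ∀ ψ ∈ s, T k ⊆ Set.ofPred ψ.Realize := by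
      classical
      induction s using Finset.induction with
      | empty => exact ⟨0, by simp⟩
      | insert ψ s _ ih =>
        obtain ⟨k, hk⟩ := ih fun x hx => hs (by simpa using Or.inr hx)
        obtain ⟨l, rfl⟩ := hs (Finset.mem_coe.2 (Finset.mem_insert_self _ _))
        refine ⟨max k l, fun χ hχ => ?_⟩
        rcases Finset.mem_insert.1 hχ with rfl | h
        · rw [← hφ l]
          exact hT (le_max_right _ _)
        · exact (hT (le_max_left _ _)).trans (hk χ h)
    obtain ⟨k, hk⟩ := this
    obtain ⟨a, ha⟩ := hne k
    exact ⟨a, fun ψ hψ => hk ψ hψ ha⟩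
  refine ⟨a, fun k => ?_⟩
  rw [hφ k]
  exact ha _ ⟨k, rfl⟩

/-- Otherwise every nonempty definable subset of `S` could be shrunk to avoid any prescribed tuple.
Doing so along an enumeration of all tuples gives a decreasing sequence with no common element,
which categoricity forbids. -/
theorem exists_isolated_mem [Countable L.Symbols] [Countable M] [Infinite M]
    (hM : Cardinal.Categorical (ℵ₀ : Cardinal.{w}) (L.completeTheory M))
    {α : Type*} [Finite α] {S : Set (α → M)} (hS : (∅ : Set M).Definable L S) (hne : S.Nonempty) :
    ∃ b ∈ S, Isolated L b := by
  by_contra! h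
  let P := {T : Set (α → M) // (∅ : Set M).Definable L T ∧ T ⊆ S ∧ T.Nonempty}
  have step : ∀ (T : P) (t : α → M), ∃ T' : P, T'.1 ⊆ T.1 ∧ t ∉ T'.1 := by
    rintro ⟨T, hT, hTS, hTne⟩ t
    by_cases ht : t ∈ T
    · have := h t (hTS ht)
      simp only [Isolated, not_exists, not_and, not_forall] at this
      obtain ⟨U, hU, htU, hTU⟩ := this T hT ht
      obtain ⟨x, hx, hxU⟩ := Set.not_subset.1 hTU
      exact ⟨⟨T \ U, hT.sdiff hU, Set.sdiff_subset.trans hTS, x, hx, hxU⟩, Set.sdiff_subset,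
        fun h => h.2 htU⟩
    · exact ⟨⟨T, hT, hTS, hTne⟩, subset_rfl, ht⟩
  choose next hnext hnot using step
  obtain ⟨t, ht⟩ := exists_surjective_nat (α → M)
  let T : ℕ → P := fun k => Nat.rec ⟨S, hS, subset_rfl, hne⟩ (fun k T => next T (t k)) k
  obtain ⟨a, ha⟩ := exists_mem_iInter_of_antitone hM (fun k => (T k).1)
    (antitone_nat_of_succ_le fun k => hnext (T k) (t k)) (fun k => (T k).2.1) fun k => (T k).2.2.2
  obtain ⟨k, rfl⟩ := ht a
  exact hnot (T k) (t k) (ha (k + 1))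

/-- This is the Tarski-Vaught step of the generic construction. An isolated tuple is found whose
`F`-part merely has the type of `F`; since that type is isolated, the isolating set of the longer
tuple also has a point lying over `F` itself. -/
theorem Isolated.exists_insert [Countable L.Symbols] [Countable M] [Infinite M]
    (hM : Cardinal.Categorical (ℵ₀ : Cardinal.{w}) (L.completeTheory M)) [DecidableEq M]
    {F : Finset M} (hF : Isolated L (fun x : F => (x : M))) {D : Set M} (hne : D.Nonempty)
    (hD : (F : Set M).Definable₁ L D) :
    ∃ y ∈ D, Isolated L (fun x : (insert y F : Finset M) => (x : M)) := by
  obtain ⟨φ, hφ⟩ := Set.definable_iff_exists_formula_sum.1 hD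
  obtain ⟨S, hS, haS, hmin⟩ := hF
  let S₁ : Set (F ⊕ Fin 1 → M) := Set.ofPred φ.Realize
  let S₂ : Set (F ⊕ Fin 1 → M) := (fun z => z ∘ Sum.inl) ⁻¹' S
  have hDφ : ∀ y, y ∈ D ↔ Sum.elim (fun x : F => (x : M)) (fun _ => y) ∈ S₁ := fun y =>
    Set.ext_iff.1 hφ (fun _ => y)
  obtain ⟨y₀, hy₀⟩ := hne
  obtain ⟨z, hz, θ, hθ, hzθ, hθmin⟩ := exists_isolated_mem hM (S := S₁ ∩ S₂)
    ((Set.empty_definable_iff.2 ⟨φ, rfl⟩).inter (hS.preimage_comp Sum.inl))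
    ⟨_, (hDφ y₀).1 hy₀, haS⟩
  have hsame : SameType L (fun x : F => (x : M)) (z ∘ Sum.inl) := sameType_of_mem hmin hz.2
  obtain ⟨z', hz'θ, hz'⟩ := (hsame _ (hθ.image_comp Sum.inl)).2 ⟨z, hzθ, rfl⟩
  have hz'S : z' ∈ S₁ := hθmin _ (Set.empty_definable_iff.2 ⟨φ, rfl⟩) hz.1 hz'θ
  have hz'iso : Isolated L z' := ⟨θ, hθ, hz'θ, fun T hT hT' =>
    hθmin T hT ((sameType_of_mem hθmin hz'θ T hT).2 hT')⟩
  have hz'eq : z' = Sum.elim (fun x : F => (x : M)) (fun _ => z' (Sum.inr 0)) := by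
    funext i
    rcases i with i | i
    · exact congrFun hz' i
    · rw [Subsingleton.elim i 0]; rfl
  refine ⟨z' (Sum.inr 0), (hDφ _).2 (hz'eq ▸ hz'S), ?_⟩
  convert hz'iso.comp (fun x : (insert (z' (Sum.inr 0)) F : Finset M) =>
    if h : (x : M) ∈ F then Sum.inl ⟨x, h⟩ else Sum.inr 0) using 1
  funext x
  by_cases h : (x : M) ∈ F
  · simpa [h] using (congrFun hz' ⟨x, h⟩).symm
  · simpa [h] using (Finset.mem_insert.1 x.2).resolve_right h

/-- In an `ℵ₀`-categorical structure the isolated tuples are abundant enough to form an elementary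
substructure. -/
theorem exists_elementarySubstructure_isolated [Countable L.Symbols] [Countable M] [Infinite M]
    (hM : Cardinal.Categorical (ℵ₀ : Cardinal.{w}) (L.completeTheory M)) :
    ∃ S : L.ElementarySubstructure M, ∀ (α : Type) [Finite α] (x : α → M),
      (∀ i, x i ∈ S) → Isolated L x := by
  classical
  let P := {F : Finset M // Isolated L (fun x : F => (x : M))}
  let W : L.Formula (M ⊕ Fin 1) → Set P := fun φ =>
    {F | ∃ y ∈ F.1, φ.Realize (Sum.elim id fun _ => y)}
  -- Allowing "no extension contains a witness" makes these sets cofinal for every formula;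
  -- `Isolated.exists_insert` later rules that case out for nonempty sets with parameters in the
  -- generic set `A`.
  let 𝒟 : L.Formula (M ⊕ Fin 1) → Order.Cofinal P := fun φ =>
    { carrier := {F | F ∈ W φ ∨ ∀ F', F ≤ F' → F' ∉ W φ}
      isCofinal := fun F => by
        by_cases h : ∃ F', F ≤ F' ∧ F' ∈ W φ
        · obtain ⟨F', hF, hF'⟩ := h
          exact ⟨F', Or.inl hF', hF⟩
        · push Not at h
          exact ⟨F, Or.inr h, le_rfl⟩ }
  have h0 : Isolated L (fun x : (∅ : Finset M) => (x : M)) :=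
    ⟨Set.univ, Set.definable_univ, trivial, fun T _ hT x _ => Subsingleton.elim _ x ▸ hT⟩
  have := Encodable.ofCountable (L.Formula (M ⊕ Fin 1))
  let I : Order.Ideal P := Order.idealOfCofinals ⟨∅, h0⟩ 𝒟
  let A : Set M := {x | ∃ F ∈ I, x ∈ F.1}
  have hfin : ∀ s : Finset M, (s : Set M) ⊆ A → ∃ F ∈ I, s ⊆ F.1 := by
    intro s
    induction s using Finset.induction with
    | empty => exact fun _ => ⟨_, Order.mem_idealOfCofinals _ _, Finset.empty_subset _⟩
    | insert x s _ ih =>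
      intro hs
      obtain ⟨F, hF, hsF⟩ := ih fun y hy => hs (by simpa using Or.inr hy)
      obtain ⟨G, hG, hxG⟩ := hs (Finset.mem_coe.2 (Finset.mem_insert_self x s))
      obtain ⟨H, hH, hFH, hGH⟩ := I.directed F hF G hG
      exact ⟨H, hH, Finset.insert_subset (hGH hxG) (hsF.trans hFH)⟩
  have hA : L.MeetsDefinable A := by
    intro D hne hD
    obtain ⟨A₀, hA₀, hD₀⟩ := Set.definable_iff_finitely_definable.1 hD
    obtain ⟨F, hF, hAF⟩ := hfin A₀ hA₀
    obtain ⟨φ, hφ⟩ := Set.definable_iff_exists_formula_sum.1 hD₀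
    let ψ : L.Formula (M ⊕ Fin 1) := φ.relabel (Sum.map (↑) id)
    have hψ : ∀ y, y ∈ D ↔ ψ.Realize (Sum.elim id fun _ => y) := fun y => by
      refine (Set.ext_iff.1 hφ (fun _ => y)).trans ?_
      simp only [ψ, Formula.realize_relabel, Set.mem_ofPred_eq]
      refine iff_of_eq (congrArg _ (funext fun i => ?_))
      rcases i with i | i <;> rfl
    obtain ⟨G, hG, hGI⟩ := Order.cofinal_meets_idealOfCofinals ⟨∅, h0⟩ 𝒟 ψ
    obtain ⟨H, hH, hFH, hGH⟩ := I.directed F hF G hGI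
    obtain ⟨y, hyD, hy⟩ := H.2.exists_insert hM hne
      (hD₀.mono (Finset.coe_subset.2 (hAF.trans hFH)))
    rcases hG with ⟨y, hyG, hy⟩ | hG
    · exact ⟨y, (hψ y).2 hy, G, hGI, hyG⟩
    · refine absurd ⟨y, Finset.mem_insert_self _ _, (hψ y).1 hyD⟩ (hG ⟨insert y H.1, hy⟩ ?_)
      exact le_trans (α := Finset M) hGH (Finset.subset_insert _ _)
  refine ⟨hA.toElementarySubstructure, fun α _ x hx => ?_⟩
  have := Fintype.ofFinite α
  have hx' : ∀ i, x i ∈ A := fun i => hA.closure_eq_self ▸ hx i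
  obtain ⟨F, -, hF⟩ := hfin (Finset.univ.image x) (by simpa [Set.subset_def] using hx')
  exact F.2.comp (fun i => ⟨x i, hF (by simp)⟩)

/-- Categoricity makes `M` isomorphic to the substructure of isolated tuples. This embeds `M`
elementarily into itself with all images of tuples isolated, and isolation pulls back along
elementary embeddings. -/
theorem isolated [Countable L.Symbols] [Countable M] [Infinite M]
    (hM : Cardinal.Categorical (ℵ₀ : Cardinal.{w}) (L.completeTheory M))
    {α : Type*} [Finite α] (a : α → M) : Isolated L a := by
  obtain ⟨S, hS⟩ := exists_elementarySubstructure_isolated hM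
  have : Infinite S := S.elementarilyEquivalent.symm.infinite
  have : Nonempty S := inferInstance
  obtain ⟨e⟩ := hM ⟨M⟩ ⟨S⟩ (mk_eq_aleph0 M) (mk_eq_aleph0 S)
  obtain ⟨n, ⟨f⟩⟩ := Finite.exists_equiv_fin α
  have h := hS (Fin n) (fun i => (e (a (f.symm i)) : M)) fun i => (e (a (f.symm i))).2
  refine Isolated.of_elementaryEmbedding
    (S.subtype.comp (show M ≃[L] S from e).toElementaryEmbedding) ?_
  convert h.comp f using 1
  funext i
  simp

end

/-! ### Homogeneity by back-and-forth -/

section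

variable {L : FirstOrder.Language.{u, v}} {M : Type w} [L.Structure M]

theorem SameType.equiv_comp {α : Type*} (a : α → M) (g : M ≃[L] M) : SameType L a (g ∘ a) := by
  intro S hS
  obtain ⟨φ, rfl⟩ := Set.empty_definable_iff.1 hS
  exact (StrongHomClass.realize_formula g φ).symm

theorem SameType.exists_extend {α : Type*} [Finite α]
    {a b : α → M} (h : SameType L a b) (x : M)
    (hx : Isolated L (Sum.elim a (fun _ : Fin 1 => x))) :
    ∃ y, SameType L (Sum.elim a (fun _ : Fin 1 => x)) (Sum.elim b (fun _ : Fin 1 => y)) := by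
  obtain ⟨S, hS, haS, hmin⟩ := hx
  obtain ⟨z, hz, hzb⟩ := (h _ (hS.image_comp Sum.inl)).1 ⟨_, haS, Sum.elim_comp_inl _ _⟩
  refine ⟨z (Sum.inr 0), ?_⟩
  have : z = Sum.elim b (fun _ => z (Sum.inr 0)) := by
    funext i
    rcases i with i | i
    · exact congrFun hzb i
    · rw [Subsingleton.elim i 0]; rfl
  exact this ▸ sameType_of_mem hmin hz

variable (L M) in
/-- Finite partial elementary maps. -/
abbrev FinitePartialElementary : Type w :=
  {F : Finset (M × M) // SameType L (fun p : F => p.1.1) (fun p : F => p.1.2)}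

theorem SameType.exists_insert [DecidableEq M] (hiso : ∀ (n : ℕ) (a : Fin n → M), Isolated L a)
    {F : Finset (M × M)} (hF : SameType L (fun p : F => p.1.1) (fun p : F => p.1.2)) (x : M) :
    ∃ y, SameType L (fun p : (insert (x, y) F : Finset (M × M)) => p.1.1)
      (fun p : (insert (x, y) F : Finset (M × M)) => p.1.2) := by
  have hiso' : Isolated L (Sum.elim (fun p : F => p.1.1) (fun _ : Fin 1 => x)) := by
    obtain ⟨n, ⟨f⟩⟩ := Finite.exists_equiv_fin (F ⊕ Fin 1)
    convert (hiso n (Sum.elim (fun p : F => p.1.1) (fun _ : Fin 1 => x) ∘ f.symm)).comp f using 1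
    funext i
    simp
  obtain ⟨y, hy⟩ := hF.exists_extend x hiso'
  refine ⟨y, ?_⟩
  let f : (insert (x, y) F : Finset (M × M)) → F ⊕ Fin 1 :=
    fun p => if h : p.1 ∈ F then Sum.inl ⟨p.1, h⟩ else Sum.inr 0
  have hf : ∀ p : (insert (x, y) F : Finset (M × M)), p.1 ∉ F → p.1 = (x, y) := fun p h =>
    (Finset.mem_insert.1 p.2).resolve_right h
  convert hy.comp f using 1 <;> funext p <;> by_cases h : p.1 ∈ F
  · simp [f, h]
  · simpa [f, h] using congrArg Prod.fst (hf p h)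
  · simp [f, h]
  · simpa [f, h] using congrArg Prod.snd (hf p h)

/-- The "back" step is the "forth" step for the inverse partial map. -/
theorem SameType.exists_insert_right [DecidableEq M]
    (hiso : ∀ (n : ℕ) (a : Fin n → M), Isolated L a)
    {F : Finset (M × M)} (hF : SameType L (fun p : F => p.1.1) (fun p : F => p.1.2)) (y : M) :
    ∃ x, SameType L (fun p : (insert (x, y) F : Finset (M × M)) => p.1.1)
      (fun p : (insert (x, y) F : Finset (M × M)) => p.1.2) := by
  let G : Finset (M × M) := F.image Prod.swap
  have hG : ∀ p : M × M, p ∈ G ↔ p.swap ∈ F := fun p => by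
    simp only [G, Finset.mem_image]
    exact ⟨by rintro ⟨q, hq, rfl⟩; simpa using hq, fun h => ⟨_, h, Prod.swap_swap p⟩⟩
  obtain ⟨x, hx⟩ := SameType.exists_insert hiso
    (hF.symm.comp (fun p : G => (⟨p.1.swap, (hG _).1 p.2⟩ : F))) y
  refine ⟨x, hx.symm.comp (fun p : (insert (x, y) F : Finset (M × M)) =>
    (⟨p.1.swap, ?_⟩ : (insert (y, x) G : Finset (M × M))))⟩
  obtain ⟨p, hp⟩ := p
  rcases Finset.mem_insert.1 hp with rfl | hp
  · simp
  · exact Finset.mem_insert_of_mem ((hG _).2 (by simpa using hp))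

/-- A bijection all of whose finite restrictions are elementary is an automorphism. -/
def equivOfSameType (g : M ≃ M) (hg : ∀ (n : ℕ) (a : Fin n → M), SameType L a (g ∘ a)) :
    M ≃[L] M where
  toEquiv := g
  map_fun' := by
    intro n f x
    have h := hg _ (Fin.cons (Structure.funMap f x) x) _
      (Set.empty_definable_iff.2 ⟨Formula.graph f, rfl⟩)
    have h1 : Formula.Realize (Formula.graph f) (Fin.cons (Structure.funMap f x) x : _ → M) :=
      Formula.realize_graph.2 rfl
    have h2 := h.1 h1
    rw [Fin.comp_cons] at h2
    exact (Formula.realize_graph.1 h2).symm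
  map_rel' := by
    intro n r x
    exact (hg n x _ (Set.empty_definable_iff.2 ⟨r.formula Term.var, rfl⟩)).symm

/-- A countable structure all of whose finite tuples are isolated is homogeneous. -/
theorem SameType.exists_equiv [Countable M] (hiso : ∀ (n : ℕ) (a : Fin n → M), Isolated L a)
    {α : Type*} [Finite α] {a b : α → M} (hab : SameType L a b) :
    ∃ g : M ≃[L] M, b = g ∘ a := by
  classical
  have := Fintype.ofFinite α
  let P := FinitePartialElementary L M
  let F₀ : Finset (M × M) := Finset.univ.image fun i => (a i, b i)
  have hF₀ : SameType L (fun p : F₀ => p.1.1) (fun p : F₀ => p.1.2) := by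
    have : ∀ p : F₀, ∃ i, (a i, b i) = p.1 := fun p => by
      obtain ⟨i, -, hi⟩ := Finset.mem_image.1 p.2
      exact ⟨i, hi⟩
    choose f hf using this
    convert hab.comp f using 1 <;> funext p <;> simp [← hf p]
  let 𝒟 : M ⊕ M → Order.Cofinal P := Sum.elim
    (fun x =>
      { carrier := {F | ∃ y, (x, y) ∈ F.1}
        isCofinal := fun F => by
          obtain ⟨y, hy⟩ := F.2.exists_insert hiso x
          exact ⟨⟨_, hy⟩, ⟨y, Finset.mem_insert_self _ _⟩, Finset.subset_insert (x, y) F.1⟩ })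
    (fun y =>
      { carrier := {F | ∃ x, (x, y) ∈ F.1}
        isCofinal := fun F => by
          obtain ⟨x, hx⟩ := F.2.exists_insert_right hiso y
          exact ⟨⟨_, hx⟩, ⟨x, Finset.mem_insert_self _ _⟩, Finset.subset_insert (x, y) F.1⟩ })
  have := Encodable.ofCountable (M ⊕ M)
  let I : Order.Ideal P := Order.idealOfCofinals ⟨F₀, hF₀⟩ 𝒟
  let R : Set (M × M) := {p | ∃ F ∈ I, p ∈ F.1}
  have hfin : ∀ s : Finset (M × M), (s : Set (M × M)) ⊆ R → ∃ F ∈ I, s ⊆ F.1 := by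
    intro s
    induction s using Finset.induction with
    | empty => exact fun _ => ⟨_, Order.mem_idealOfCofinals _ _, Finset.empty_subset _⟩
    | insert x s _ ih =>
      intro hs
      obtain ⟨F, hF, hsF⟩ := ih fun y hy => hs (by
        rw [Finset.coe_insert]; exact Or.inr hy)
      obtain ⟨G, hG, hxG⟩ := hs (Finset.mem_coe.2 (Finset.mem_insert_self x s))
      obtain ⟨H, hH, hFH, hGH⟩ := I.directed F hF G hG
      exact ⟨H, hH, Finset.insert_subset (hGH hxG) (hsF.trans hFH)⟩
  have hR : ∀ (n : ℕ) (x y : Fin n → M), (∀ i, (x i, y i) ∈ R) → SameType L x y := by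
    intro n x y hxy
    obtain ⟨F, -, hF⟩ := hfin (Finset.univ.image fun i => (x i, y i))
      (by intro p hp; obtain ⟨i, -, rfl⟩ := Finset.mem_image.1 hp; exact hxy i)
    exact F.2.comp (fun i => (⟨(x i, y i), hF (Finset.mem_image_of_mem _ (Finset.mem_univ i))⟩ : F.1))
  -- Preservation of the formula `x₀ = x₁` makes the generic relation `R` single-valued and
  -- injective.
  have heq : ∀ p ∈ R, ∀ q ∈ R, (p.1 = q.1 ↔ p.2 = q.2) := by
    intro p hp q hq
    have h := hR 2 ![p.1, q.1] ![p.2, q.2] (by simp [Fin.forall_fin_two, hp, hq]) _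
      (Set.empty_definable_iff.2 ⟨(Term.var 0).equal (Term.var 1), rfl⟩)
    simpa using h
  have hl : ∀ x, ∃ y, (x, y) ∈ R := fun x => by
    obtain ⟨F, ⟨y, hy⟩, hF⟩ := Order.cofinal_meets_idealOfCofinals ⟨F₀, hF₀⟩ 𝒟 (Sum.inl x)
    exact ⟨y, F, hF, hy⟩
  have hr : ∀ y, ∃ x, (x, y) ∈ R := fun y => by
    obtain ⟨F, ⟨x, hx⟩, hF⟩ := Order.cofinal_meets_idealOfCofinals ⟨F₀, hF₀⟩ 𝒟 (Sum.inr y)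
    exact ⟨x, F, hF, hx⟩
  choose f hf using hl
  choose f' hf' using hr
  let g : M ≃ M :=
    { toFun := f
      invFun := f'
      left_inv := fun x => (heq _ (hf' (f x)) _ (hf x)).2 rfl
      right_inv := fun y => (heq _ (hf (f' y)) _ (hf' y)).1 rfl }
  refine ⟨equivOfSameType g fun n x => hR n x _ fun i => hf (x i), funext fun i => ?_⟩
  refine (heq (a i, b i) ⟨_, Order.mem_idealOfCofinals _ _, ?_⟩ _ (hf (a i))).1 rfl
  exact Finset.mem_image_of_mem _ (Finset.mem_univ i)

theorem mem_orbitOver_self (C : Set M) {n : ℕ} (a : Fin n → M) : a ∈ orbitOver L C a :=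
  ⟨.refl L M, fun _ _ => rfl, rfl⟩

/-! ### Ryll-Nardzewski: finitely many types, definability as invariance -/

section Categorical

variable [Countable L.Symbols] [Countable M] [Infinite M]

theorem exists_equiv_of_sameType
    (hM : Cardinal.Categorical (ℵ₀ : Cardinal.{w}) (L.completeTheory M))
    {α : Type*} [Finite α] {a b : α → M} (hab : SameType L a b) :
    ∃ g : M ≃[L] M, b = g ∘ a :=
  hab.exists_equiv fun _ a => isolated hM a

/-- If finitely many types did not suffice, the negations of all isolating formulas would be
finitely satisfiable, hence realised by some `b`; but `b` satisfies its own isolating formula. -/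
theorem exists_finset_sameType
    (hM : Cardinal.Categorical (ℵ₀ : Cardinal.{w}) (L.completeTheory M))
    (α : Type*) [Finite α] : ∃ s : Finset (α → M), ∀ b, ∃ a ∈ s, SameType L a b := by
  classical
  choose S hS haS hmin using fun a : α → M => isolated hM a
  choose φ hφ using fun a => Set.empty_definable_iff.1 (hS a)
  by_contra! h
  obtain ⟨b, hb⟩ := exists_realize_of_finitely_realize hM (Set.range fun a => ∼(φ a)) fun s hs => by
    obtain ⟨t, ht⟩ : ∃ t : Finset (α → M), s ⊆ t.image fun a => ∼(φ a) := by
      obtain ⟨t, -, ht⟩ := Finset.subset_set_image_iff.1 (Set.image_univ ▸ hs)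
      exact ⟨t, ht.ge⟩
    obtain ⟨b, hb⟩ := h t
    refine ⟨b, fun ψ hψ => ?_⟩
    obtain ⟨a, ha, rfl⟩ := Finset.mem_image.1 (ht hψ)
    refine Formula.realize_not.2 fun hr => hb a ha (sameType_of_mem (hmin a) ?_)
    rw [hφ a]
    exact hr
  refine Formula.realize_not.1 (hb _ ⟨b, rfl⟩) ?_
  have := haS b
  rw [hφ b] at this
  exact this

/-- By homogeneity an invariant set is a union of isolating sets, and finitely many of these exhaust
all types. -/
theorem definable_of_invariant
    (hM : Cardinal.Categorical (ℵ₀ : Cardinal.{w}) (L.completeTheory M))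
    {α : Type*} [Finite α] {S : Set (α → M)} (hS : ∀ (g : M ≃[L] M), ∀ x ∈ S, g ∘ x ∈ S) :
    (∅ : Set M).Definable L S := by
  classical
  choose T hT haT hmin using fun a : α → M => isolated hM a
  obtain ⟨s, hs⟩ := exists_finset_sameType hM α
  have : S = ⋃ a ∈ s.filter (· ∈ S), T a := by
    ext x
    simp only [Set.mem_iUnion, Finset.mem_filter]
    constructor
    · intro hx
      obtain ⟨a, ha, hax⟩ := hs x
      obtain ⟨g, rfl⟩ := exists_equiv_of_sameType hM hax.symm
      exact ⟨_, ⟨ha, hS g x hx⟩, (hax _ (hT _)).1 (haT _)⟩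
    · rintro ⟨a, ⟨-, ha⟩, hx⟩
      obtain ⟨g, rfl⟩ := exists_equiv_of_sameType hM (sameType_of_mem (hmin a) hx)
      exact hS g a ha
  rw [this]
  exact Set.definable_biUnion_finset hT _

/-- Over a finite set of parameters, the definable sets are the sets invariant under the
automorphisms fixing the parameters. -/
theorem definable_iff_invariant
    (hM : Cardinal.Categorical (ℵ₀ : Cardinal.{w}) (L.completeTheory M))
    {α : Type*} [Finite α] {C : Set M} (hC : C.Finite) {S : Set (α → M)} :
    C.Definable L S ↔ ∀ g : M ≃[L] M, (∀ c ∈ C, g c = c) → ∀ x ∈ S, g ∘ x ∈ S := by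
  constructor
  · intro h g hg x hx
    obtain ⟨φ, rfl⟩ := Set.definable_iff_exists_formula_sum.1 h
    have hx' : φ.Realize (Sum.elim (↑) x) := hx
    have e : (Sum.elim (↑) (g ∘ x) : C ⊕ α → M) = g ∘ Sum.elim (↑) x := by
      funext i
      rcases i with i | i
      · exact (hg i i.2).symm
      · rfl
    have h := (StrongHomClass.realize_formula g φ).2 hx'
    rw [← e] at h
    exact h
  · intro h
    have := hC.to_subtype
    -- Prefixing an enumeration of `C` and closing under all automorphisms gives a `∅`-definable
    -- set; its fibre over the actual parameters `C` is `S`.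
    have hdef : (∅ : Set M).Definable L
        {z : C ⊕ α → M | ∃ g : M ≃[L] M, ∃ x ∈ S, z = g ∘ Sum.elim (↑) x} := by
      refine definable_of_invariant hM ?_
      rintro g _ ⟨g', x, hx, rfl⟩
      exact ⟨g.comp g', x, hx, rfl⟩
    obtain ⟨φ, hφ⟩ := Set.empty_definable_iff.1 hdef
    refine Set.definable_iff_exists_formula_sum.2 ⟨φ, Set.ext fun v => ?_⟩
    refine Iff.trans ?_ (Set.ext_iff.1 hφ (Sum.elim (↑) v))
    constructor
    · exact fun hv => ⟨.refl L M, v, hv, rfl⟩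
    · rintro ⟨g, x, hx, hgx⟩
      have h1 : v = g ∘ x := funext fun i => congrFun hgx (Sum.inr i)
      rw [h1]
      exact h g (fun c hc => (congrFun hgx (Sum.inl ⟨c, hc⟩)).symm) x hx

theorem orbitOver_definable
    (hM : Cardinal.Categorical (ℵ₀ : Cardinal.{w}) (L.completeTheory M))
    {C : Set M} (hC : C.Finite) {n : ℕ} (a : Fin n → M) : C.Definable L (orbitOver L C a) := by
  rw [definable_iff_invariant hM hC]
  rintro g hg _ ⟨g', hg', rfl⟩
  exact ⟨g.comp g', fun c hc => by simp [hg' c hc, hg c hc], rfl⟩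

/-- The orbit is itself `C`-definable, so realisations of the type fall into it; conversely,
automorphisms over `C` preserve formulas over `C`. -/
theorem typeSet_eq_orbitOver
    (hM : Cardinal.Categorical (ℵ₀ : Cardinal.{w}) (L.completeTheory M))
    {C : Set M} (hC : C.Finite) {n : ℕ} (a : Fin n → M) : typeSet L C a = orbitOver L C a := by
  ext x
  constructor
  · intro hx
    obtain ⟨φ, hφ⟩ := orbitOver_definable hM hC a
    have ha := mem_orbitOver_self (L := L) C a
    rw [hφ] at ha ⊢
    exact (hx φ).2 ha
  · rintro ⟨g, hg, rfl⟩ φ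
    have key : ∀ ψ : L[[C]].Formula (Fin n), ψ.Realize a → ψ.Realize (g ∘ a) := fun ψ h =>
      (definable_iff_invariant hM hC).1 ⟨ψ, rfl⟩ g hg a h
    refine ⟨fun h => ?_, key φ⟩
    by_contra hn
    exact Formula.realize_not.1 (key (∼φ) (Formula.realize_not.2 hn)) h

theorem finite_orbitOver
    (hM : Cardinal.Categorical (ℵ₀ : Cardinal.{w}) (L.completeTheory M))
    {C : Set M} (hC : C.Finite) (n : ℕ) :
    (Set.range fun a : Fin n → M => orbitOver L C a).Finite := by
  have := hC.to_subtype
  obtain ⟨s, hs⟩ := exists_finset_sameType hM (C ⊕ Fin n)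
  refine (s.finite_toSet.image fun z => {x | SameType L z (Sum.elim (↑) x)}).subset ?_
  rintro _ ⟨a, rfl⟩
  obtain ⟨z, hz, hza⟩ := hs (Sum.elim (↑) a)
  refine ⟨z, hz, Set.ext fun x => ⟨fun hx => ?_, ?_⟩⟩
  · have : SameType L (Sum.elim ((↑) : C → M) a) (Sum.elim (↑) x) := fun S hS =>
      (hza S hS).symm.trans (hx S hS)
    obtain ⟨g, hg⟩ := exists_equiv_of_sameType hM this
    exact ⟨g, fun c hc => (congrFun hg (Sum.inl ⟨c, hc⟩)).symm,
      funext fun i => congrFun hg (Sum.inr i)⟩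
  · rintro ⟨g, hg, rfl⟩ S hS
    refine (hza S hS).trans ((SameType.equiv_comp _ g S hS).trans ?_)
    refine iff_of_eq (congrArg (· ∈ S) (funext fun i => ?_))
    rcases i with i | i
    · exact hg i i.2
    · rfl

end Categorical

end

/-! ### Arithmetic of leading terms -/

section

/-- The sum of `f` over `s`, where `(d, μ)` is thought of as the leading term `μ T ^ d`. -/
def leadingSum {ι : Type*} (s : Finset ι) (f : ι → ℕ × ℝ) : ℕ × ℝ :=
  (s.sup fun i => (f i).1, ∑ i ∈ s with (f i).1 = s.sup fun i => (f i).1, (f i).2)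

/-- The product of leading terms. -/
def leadingMul (x y : ℕ × ℝ) : ℕ × ℝ :=
  (x.1 + y.1, x.2 * y.2)

theorem leadingMul_comm (x y : ℕ × ℝ) : leadingMul x y = leadingMul y x := by
  simp only [leadingMul, add_comm, mul_comm]

theorem leadingSum_congr {ι : Type*} {s : Finset ι} {f g : ι → ℕ × ℝ} (h : ∀ i ∈ s, f i = g i) :
    leadingSum s f = leadingSum s g := by
  have hsup : (s.sup fun i => (f i).1) = s.sup fun i => (g i).1 :=
    Finset.sup_congr rfl fun i hi => by rw [h i hi]
  refine Prod.ext hsup (Finset.sum_congr ?_ fun i hi => ?_)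
  · rw [hsup]
    exact Finset.filter_congr fun i hi => by rw [h i hi]
  · rw [h i (Finset.mem_filter.1 hi).1]

theorem leadingSum_image {ι κ : Type*} [DecidableEq κ] {s : Finset ι} {π : ι → κ}
    (hπ : Set.InjOn π s) (f : κ → ℕ × ℝ) :
    leadingSum (s.image π) f = leadingSum s fun i => f (π i) := by
  have hsup : ((s.image π).sup fun i => (f i).1) = s.sup fun i => (f (π i)).1 := Finset.sup_image _ _ _
  refine Prod.ext hsup ?_
  simp only [leadingSum, hsup, Finset.filter_image]
  exact Finset.sum_image (hπ.mono (Finset.coe_subset.2 (Finset.filter_subset _ _)))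

/-- Only terms of the overall top degree matter, and each lies in a group whose own top degree is
the overall one. Empty groups contribute `(0, 0)`, which is harmless. -/
theorem leadingSum_fiberwise {ι κ : Type*} [DecidableEq κ] {s : Finset ι} {t : Finset κ}
    {π : ι → κ} (hπ : ∀ i ∈ s, π i ∈ t) (f : ι → ℕ × ℝ) :
    leadingSum t (fun j => leadingSum (s.filter fun i => π i = j) f) = leadingSum s f := by
  have hle : ∀ j, ((s.filter fun i => π i = j).sup fun i => (f i).1) ≤ s.sup fun i => (f i).1 :=
    fun j => Finset.sup_mono (Finset.filter_subset _ _)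
  have hge : ∀ i ∈ s, (f i).1 ≤ (s.filter fun i' => π i' = π i).sup fun i => (f i).1 := fun i hi =>
    Finset.le_sup (f := fun i => (f i).1) (Finset.mem_filter.2 ⟨hi, rfl⟩)
  have hsup : (t.sup fun j => (s.filter fun i => π i = j).sup fun i => (f i).1) =
      s.sup fun i => (f i).1 := by
    refine le_antisymm (Finset.sup_le fun j _ => hle j) (Finset.sup_le fun i hi => ?_)
    exact (hge i hi).trans (Finset.le_sup
      (f := fun j => (s.filter fun i => π i = j).sup fun i => (f i).1) (hπ i hi))
  refine Prod.ext hsup ?_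
  simp only [leadingSum, hsup]
  rw [← Finset.sum_fiberwise_of_maps_to (g := π)
    (t := t.filter fun j => ((s.filter fun i => π i = j).sup fun i => (f i).1) =
      s.sup fun i => (f i).1)]
  · refine Finset.sum_congr rfl fun j hj => Finset.sum_congr ?_ fun _ _ => rfl
    rw [(Finset.mem_filter.1 hj).2, Finset.filter_comm]
  · intro i hi
    obtain ⟨hi, hi'⟩ := Finset.mem_filter.1 hi
    exact Finset.mem_filter.2 ⟨hπ i hi, le_antisymm (hle _) (hi' ▸ hge i hi)⟩

/-- Nonemptiness is essential: the empty sum is `(0, 0)`, whereas multiplying it by `c` gives `(c.1,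
0)`. -/
theorem leadingSum_mul {ι : Type*} {s : Finset ι} (hs : s.Nonempty) (c : ℕ × ℝ)
    (f : ι → ℕ × ℝ) :
    leadingSum s (fun i => leadingMul c (f i)) = leadingMul c (leadingSum s f) := by
  have hsup : (s.sup fun i => c.1 + (f i).1) = c.1 + s.sup fun i => (f i).1 := by
    refine le_antisymm (Finset.sup_le fun i hi => Nat.add_le_add_left
      (Finset.le_sup (f := fun i => (f i).1) hi) _) ?_
    obtain ⟨i, hi, h⟩ := Finset.exists_mem_eq_sup s hs fun i => (f i).1
    rw [h]
    exact Finset.le_sup (f := fun i => c.1 + (f i).1) hi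
  refine Prod.ext hsup ?_
  simp only [leadingSum, leadingMul, hsup, Finset.mul_sum, Nat.add_left_cancel_iff]

theorem leadingSum_const {ι : Type*} {s : Finset ι} (hs : s.Nonempty) {f : ι → ℕ × ℝ} {c : ℕ × ℝ}
    (hf : ∀ i ∈ s, f i = c) : leadingSum s f = leadingMul c (0, (s.card : ℝ)) := by
  rw [leadingSum_congr hf]
  simp [leadingSum, leadingMul, Finset.sup_const hs, mul_comm]

theorem leadingSum_singleton {ι : Type*} (i : ι) (f : ι → ℕ × ℝ) :
    leadingSum {i} f = f i := by
  rw [leadingSum_const (Finset.singleton_nonempty i) (c := f i) (by simp)]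
  simp [leadingMul]

variable {L : FirstOrder.Language.{u, v}} {M : Type w} [L.Structure M]

/-- This packs the separate `dim` and `meas` clauses of MS4 and cMS2 into one equation; there the
top terms are selected by comparison with `dim X`. -/
theorem eq_leadingSum_iff {ι : Type*} {s : Finset ι} {f : ι → ℕ × ℝ} {x : ℕ × ℝ} :
    x = leadingSum s f ↔
      x.1 = s.sup (fun i => (f i).1) ∧ x.2 = ∑ i ∈ s with (f i).1 = x.1, (f i).2 := by
  constructor
  · rintro rfl
    exact ⟨rfl, rfl⟩
  · rintro ⟨h1, h2⟩
    refine Prod.ext h1 ?_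
    rw [h2, h1]
    rfl

/-! ### Translates, orbits and closures -/

/-- The translate of a set of tuples by an automorphism. -/
def translate {α : Type*} (g : M ≃[L] M) (X : Set (α → M)) : Set (α → M) :=
  (fun x => g ∘ x) '' X

theorem mem_translate {α : Type*} {g : M ≃[L] M} {X : Set (α → M)} {x : α → M} :
    x ∈ translate g X ↔ g.symm ∘ x ∈ X := by
  constructor
  · rintro ⟨y, hy, rfl⟩
    convert hy using 1
    funext i
    simp
  · intro h
    refine ⟨_, h, ?_⟩
    funext i
    simp

theorem translate_injective {α : Type*} (g : M ≃[L] M) :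
    Function.Injective (translate g : Set (α → M) → Set (α → M)) :=
  Set.image_injective.2 fun _ _ h => funext fun i => g.injective (congrFun h i)

theorem symm_apply_of_fixes {C : Set M} {g : M ≃[L] M} (hg : ∀ c ∈ C, g c = c) :
    ∀ c ∈ C, g.symm c = c := fun c hc => by
  conv_lhs => rw [← hg c hc]
  exact g.symm_apply_apply c

theorem orbitOver_eq_of_mem {C : Set M} {n : ℕ} {a x : Fin n → M} (hx : x ∈ orbitOver L C a) :
    orbitOver L C x = orbitOver L C a := by
  obtain ⟨g, hg, rfl⟩ := hx
  ext y
  constructor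
  · rintro ⟨g', hg', rfl⟩
    exact ⟨g'.comp g, fun c hc => by simp [hg c hc, hg' c hc], rfl⟩
  · rintro ⟨g', hg', rfl⟩
    refine ⟨g'.comp g.symm, fun c hc => ?_, ?_⟩
    · rw [Equiv.comp_apply, symm_apply_of_fixes hg c hc, hg' c hc]
    · funext i
      simp

theorem mem_orbitOver_iff {C : Set M} {n : ℕ} {a x : Fin n → M} :
    x ∈ orbitOver L C a ↔ orbitOver L C x = orbitOver L C a :=
  ⟨orbitOver_eq_of_mem, fun h => h ▸ mem_orbitOver_self C x⟩

theorem translate_orbitOver (C : Set M) {n : ℕ} (a : Fin n → M) (g : M ≃[L] M) :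
    translate g (orbitOver L C a) = orbitOver L (g '' C) (g ∘ a) := by
  ext x
  rw [mem_translate]
  constructor
  · rintro ⟨g', hg', h⟩
    refine ⟨(g.comp g').comp g.symm, ?_, ?_⟩
    · rintro _ ⟨c, hc, rfl⟩
      simp [hg' c hc]
    · funext i
      have := congrFun h i
      simp only [Function.comp_apply] at this
      simp [← this]
  · rintro ⟨g', hg', rfl⟩
    refine ⟨(g.symm.comp g').comp g, fun c hc => ?_, ?_⟩
    · simp [hg' _ ⟨c, hc, rfl⟩]
    · funext i
      simp

theorem translate_solutionSet {n m : ℕ} (φ : L.Formula (Fin n ⊕ Fin m)) (a : Fin m → M)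
    (g : M ≃[L] M) : translate g (solutionSet φ a) = solutionSet φ (g ∘ a) := by
  ext x
  rw [mem_translate]
  have h := StrongHomClass.realize_formula g φ (v := Sum.elim (g.symm ∘ x) a)
  have e : g ∘ Sum.elim (g.symm ∘ x) a = Sum.elim x (g ∘ a) := by
    funext i
    rcases i with i | i <;> simp
  rw [e] at h
  exact h.symm

theorem solutionSet_definable {n m : ℕ} (φ : L.Formula (Fin n ⊕ Fin m)) (a : Fin m → M) :
    (Set.range a).Definable L (solutionSet φ a) := by
  refine Set.definable_iff_exists_formula_sum.2
    ⟨φ.relabel (Sum.elim Sum.inr fun j => Sum.inl ⟨a j, j, rfl⟩), Set.ext fun x => ?_⟩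
  simp only [solutionSet, Set.mem_ofPred_eq, Formula.realize_relabel]
  refine iff_of_eq (congrArg _ (funext fun i => ?_))
  rcases i with i | i <;> rfl

theorem exists_eq_solutionSet {n : ℕ} {X : Set (Fin n → M)}
    (hX : (Set.univ : Set M).Definable L X) :
    ∃ (m : ℕ) (φ : L.Formula (Fin n ⊕ Fin m)) (a : Fin m → M), X = solutionSet φ a := by
  obtain ⟨A, -, hA⟩ := Set.definable_iff_finitely_definable.1 hX
  obtain ⟨φ, rfl⟩ := Set.definable_iff_exists_formula_sum.1 hA
  refine ⟨_, φ.relabel (Sum.elim (fun c => Sum.inr (A.equivFin c)) Sum.inl),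
    fun j => A.equivFin.symm j, Set.ext fun x => ?_⟩
  simp only [solutionSet, Set.mem_ofPred_eq, Formula.realize_relabel]
  refine iff_of_eq (congrArg _ (funext fun i => ?_))
  rcases i with i | i
  · simp
  · rfl

theorem definable_translate {α : Type*} {C : Set M} (hC : C.Finite) [Finite α]
    [Countable L.Symbols] [Countable M] [Infinite M]
    (hM : Cardinal.Categorical (ℵ₀ : Cardinal.{w}) (L.completeTheory M))
    {X : Set (α → M)} (hX : C.Definable L X) (g : M ≃[L] M) :
    (g '' C).Definable L (translate g X) := by
  rw [definable_iff_invariant hM (hC.image g)]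
  rintro g' hg' _ ⟨x, hx, rfl⟩
  rw [mem_translate]
  refine (definable_iff_invariant hM hC).1 hX ((g.symm.comp g').comp g) (fun c hc => ?_) x hx
  simp [hg' _ ⟨c, hc, rfl⟩]

theorem mem_dcl_iff [Countable L.Symbols] [Countable M] [Infinite M]
    (hM : Cardinal.Categorical (ℵ₀ : Cardinal.{w}) (L.completeTheory M))
    {C : Set M} (hC : C.Finite) {d : M} :
    d ∈ dcl L C ↔ ∀ g : M ≃[L] M, (∀ c ∈ C, g c = c) → g d = d := by
  refine (definable_iff_invariant hM hC).trans ?_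
  refine forall₂_congr fun g hg => ⟨fun h => h (fun _ => d) rfl, fun h x hx => ?_⟩
  exact (congrArg g hx).trans h

/-- Coordinate projections of a finite orbit are finite and `C`-definable; conversely the orbit lies
in a finite product of finite `C`-definable sets. -/
theorem finite_orbitOver_iff [Countable L.Symbols] [Countable M] [Infinite M]
    (hM : Cardinal.Categorical (ℵ₀ : Cardinal.{w}) (L.completeTheory M))
    {C : Set M} (hC : C.Finite) {n : ℕ} {a : Fin n → M} :
    (orbitOver L C a).Finite ↔ ∀ i, a i ∈ acl L C := by
  constructor
  · intro h i
    refine ⟨(fun x => x i) '' orbitOver L C a, h.image _, ?_, a, mem_orbitOver_self C a, rfl⟩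
    refine (definable_iff_invariant hM hC).2 ?_
    rintro g hg x ⟨_, ⟨g', hg', rfl⟩, hx⟩
    refine ⟨_, ⟨g.comp g', fun c hc => by simp [hg' c hc, hg c hc], rfl⟩, ?_⟩
    exact congrArg g hx
  · intro h
    choose S hS hdef hmem using h
    refine (Set.Finite.pi' hS).subset ?_
    rintro _ ⟨g, hg, rfl⟩ i
    exact (definable_iff_invariant hM hC).1 (hdef i) g hg (fun _ => a i) (hmem i)

open Classical in
variable (L) in
/-- The set of orbits over `C` of the elements of `X`, if finite. -/
def orbits {n : ℕ} (C : Set M) (X : Set (Fin n → M)) : Finset (Set (Fin n → M)) :=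
  if h : ((orbitOver L C) '' X).Finite then h.toFinset else ∅

theorem mem_orbits [Countable L.Symbols] [Countable M] [Infinite M]
    (hM : Cardinal.Categorical (ℵ₀ : Cardinal.{w}) (L.completeTheory M))
    {C : Set M} (hC : C.Finite) {n : ℕ} {X O : Set (Fin n → M)} :
    O ∈ orbits L C X ↔ ∃ a ∈ X, orbitOver L C a = O := by
  have h : ((orbitOver L C) '' X).Finite :=
    (finite_orbitOver hM hC n).subset (Set.image_subset_range _ _)
  rw [orbits, dif_pos h, Set.Finite.mem_toFinset]
  rfl

end

/-! ### From MS to cMS -/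

section

variable {L : FirstOrder.Language.{u, v}} {M : Type w} [L.Structure M]

/-- By MS3 the parameters giving a fixed value form a `∅`-definable set, which automorphisms
preserve. -/
theorem IsMS.val_translate {h : ValueFunction L M} (hh : IsMS h) {n : ℕ}
    {X : Set (Fin (n + 1) → M)} (hX : (Set.univ : Set M).Definable L X) (g : M ≃[L] M) :
    h.val (translate g X) = h.val X := by
  obtain ⟨m, φ, a, rfl⟩ := exists_eq_solutionSet hX
  rw [translate_solutionSet]
  exact ((SameType.equiv_comp a g) _ (hh.ms3 n m φ (h.val (solutionSet φ a)))).1 rfl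

theorem IsMS.val_of_finite {h : ValueFunction L M} (hh : IsMS h) {n : ℕ}
    {X : Set (Fin (n + 1) → M)} (hX : (Set.univ : Set M).Definable L X) (hfin : X.Finite) :
    h.val X = (0, (X.ncard : ℝ)) := by
  obtain ⟨m, φ, a, rfl⟩ := exists_eq_solutionSet hX
  exact hh.ms2 n m φ a hfin

theorem IsMS.val_eq_leadingSum {h : ValueFunction L M} (hh : IsMS h) {n m : ℕ}
    {X : Set (Fin (n + 1) → M)} {Y : Set (Fin (m + 1) → M)} {f : (Fin (n + 1) → M) → Fin (m + 1) → M}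
    (hX : (Set.univ : Set M).Definable L X) (hY : (Set.univ : Set M).Definable L Y)
    (hf : IsDefinableSurjection L X Y f) :
    ∃ D : Finset (ℕ × ℝ), (D : Set (ℕ × ℝ)) = (fun b => h.val (fibre X f b)) '' Y ∧
      h.val X = leadingSum D fun v => leadingMul v (h.val (h.level X Y f v)) := by
  obtain ⟨D, hD, -, h1, h2⟩ := hh.ms4 n m X Y f hX hY hf
  exact ⟨D, hD, eq_leadingSum_iff.2 ⟨h1, h2⟩⟩

variable [Countable L.Symbols] [Countable M] [Infinite M]

/-- Additivity over a finite partition, obtained from Fubini for the map to a finite set of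
indices. -/
theorem IsMS.val_iUnion {h : ValueFunction L M} (hh : IsMS h)
    (hM : Cardinal.Categorical (ℵ₀ : Cardinal.{w}) (L.completeTheory M)) {n k : ℕ} {C : Set M}
    (hC : C.Finite) (T : Fin k → Set (Fin (n + 1) → M)) (hT : ∀ i, C.Definable L (T i))
    (hne : ∀ i, (T i).Nonempty) (hdisj : Pairwise fun i j => Disjoint (T i) (T j)) :
    h.val (⋃ i, T i) = leadingSum Finset.univ fun i => h.val (T i) := by
  classical
  -- The indices are coded by distinct points of the infinite `M`, so that the index map becomes a
  -- definable function.
  let y : Fin k ↪ M := (Fin.valEmbedding).trans (Infinite.natEmbedding M)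
  let c : Fin k → Fin (0 + 1) → M := fun i _ => y i
  have hc : Function.Injective c := fun i j hij => y.injective (congrFun hij 0)
  let f : (Fin (n + 1) → M) → Fin (0 + 1) → M := fun x =>
    if h : ∃ i, x ∈ T i then c h.choose else fun _ => Classical.arbitrary M
  have hfT : ∀ i, ∀ x ∈ T i, f x = c i := fun i x hx => by
    have hex : ∃ i, x ∈ T i := ⟨i, hx⟩
    simp only [f, dif_pos hex]
    refine congrArg c ?_
    by_contra hn
    exact Set.disjoint_left.1 (hdisj hn) hex.choose_spec hx
  let X := ⋃ i, T i
  let Y : Set (Fin (0 + 1) → M) := Set.range c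
  have hYfin : Y.Finite := Set.finite_range c
  let C' : Set M := C ∪ Set.range y
  have hC' : C'.Finite := hC.union (Set.finite_range y)
  have hinv : ∀ g : M ≃[L] M, (∀ c ∈ C', g c = c) → (∀ i, ∀ x ∈ T i, g ∘ x ∈ T i) ∧
      ∀ i, g ∘ c i = c i := fun g hg =>
    ⟨fun i x hx => (definable_iff_invariant hM hC).1 (hT i) g (fun c hc => hg c (Or.inl hc)) x hx,
      fun i => funext fun _ => hg _ (Or.inr ⟨i, rfl⟩)⟩
  have hX : (Set.univ : Set M).Definable L X :=
    (Set.definable_iUnion_of_finite hT).mono (Set.subset_univ _)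
  have hYsub : ∀ Z ⊆ Y, (Set.univ : Set M).Definable L Z := fun Z hZ => by
    refine ((definable_iff_invariant hM hC').2 fun g hg z hz => ?_).mono (Set.subset_univ C')
    obtain ⟨i, rfl⟩ := hZ hz
    rwa [(hinv g hg).2 i]
  have hsurj : IsDefinableSurjection L X Y f := by
    refine ⟨?_, ((definable_iff_invariant hM hC').2 ?_).mono (Set.subset_univ C')⟩
    · ext b
      constructor
      · rintro ⟨x, hx, rfl⟩
        obtain ⟨i, hi⟩ := Set.mem_iUnion.1 hx
        exact ⟨i, (hfT i x hi).symm⟩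
      · rintro ⟨i, rfl⟩
        obtain ⟨x, hx⟩ := hne i
        exact ⟨x, Set.mem_iUnion.2 ⟨i, hx⟩, hfT i x hx⟩
    · rintro g hg z ⟨hz, hfz⟩
      obtain ⟨i, hi⟩ := Set.mem_iUnion.1 hz
      have hgi : (g ∘ z) ∘ Sum.inl ∈ T i := (hinv g hg).1 i _ hi
      refine ⟨Set.mem_iUnion.2 ⟨i, hgi⟩, ?_⟩
      rw [hfT i _ hgi, Function.comp_assoc, ← hfz, hfT i _ hi, (hinv g hg).2]
  have hfib : ∀ i, fibre X f (c i) = T i := fun i => by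
    ext x
    constructor
    · rintro ⟨hx, hfx⟩
      obtain ⟨j, hj⟩ := Set.mem_iUnion.1 hx
      rw [hfT j x hj] at hfx
      rwa [hc hfx] at hj
    · exact fun hx => ⟨Set.mem_iUnion.2 ⟨i, hx⟩, hfT i x hx⟩
  obtain ⟨D, hD, hval⟩ := hh.val_eq_leadingSum hX (hYsub Y subset_rfl) hsurj
  have hDimg : ∀ v, v ∈ D ↔ ∃ i, h.val (T i) = v := fun v => by
    rw [← Finset.mem_coe, hD]
    simp only [Y, Set.mem_image, Set.mem_range, exists_exists_eq_and, hfib]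
  -- Pieces with equal value `v` are merged by Fubini into one term: the level set over `v` is
  -- finite, and MS2 makes its measure the number of such pieces.
  refine hval.trans (Eq.trans ?_ (leadingSum_fiberwise (t := D) (π := fun i => h.val (T i))
    (fun i _ => (hDimg _).2 ⟨i, rfl⟩) _))
  refine leadingSum_congr fun v hv => ?_
  obtain ⟨i, hi⟩ := (hDimg v).1 hv
  rw [leadingSum_const (c := v) ⟨i, Finset.mem_filter.2 ⟨Finset.mem_univ i, hi⟩⟩
    (fun j hj => (Finset.mem_filter.1 hj).2)]
  have hlev : h.level X Y f v = ((Finset.univ.filter fun i => h.val (T i) = v).image c :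
      Finset (Fin (0 + 1) → M)) := by
    ext b
    simp only [ValueFunction.level, Finset.coe_image, Set.mem_image, Finset.mem_coe,
      Finset.mem_filter, Finset.mem_univ, true_and]
    constructor
    · rintro ⟨⟨j, rfl⟩, hj⟩
      exact ⟨j, by rwa [hfib] at hj, rfl⟩
    · rintro ⟨j, hj, rfl⟩
      exact ⟨⟨j, rfl⟩, by rwa [hfib]⟩
  have hlevY : h.level X Y f v ⊆ Y := fun b hb => hb.1
  rw [hh.val_of_finite (hYsub _ hlevY) (hYfin.subset hlevY), hlev, Set.ncard_coe_finset,
    Finset.card_image_of_injective _ hc]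

/-- Since `b` is fixed by automorphisms fixing `C` and `a`, the map `g a ↦ g b` is well defined
between the orbits. Each fibre is a translate of the orbit of `a` over `C` and `b`, so Fubini has a
single term. -/
theorem IsMS.val_orbitOver {h : ValueFunction L M} (hh : IsMS h)
    (hM : Cardinal.Categorical (ℵ₀ : Cardinal.{w}) (L.completeTheory M)) {n m : ℕ} {C : Set M}
    (hC : C.Finite) (a : Fin (n + 1) → M) (b : Fin (m + 1) → M)
    (hb : ∀ i, b i ∈ dcl L (C ∪ Set.range a)) :
    h.val (orbitOver L C a) =
      leadingMul (h.val (orbitOver L C b)) (h.val (orbitOver L (C ∪ Set.range b) a)) := by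
  classical
  have hfix : ∀ g : M ≃[L] M, (∀ c ∈ C, g c = c) → g ∘ a = a → g ∘ b = b := fun g hg hga =>
    funext fun i => (mem_dcl_iff hM (hC.union (Set.finite_range a))).1 (hb i) g (by
      rintro c (hc | ⟨j, rfl⟩)
      · exact hg c hc
      · exact congrFun hga j)
  let X := orbitOver L C a
  let Y := orbitOver L C b
  let f : (Fin (n + 1) → M) → Fin (m + 1) → M := fun x =>
    if hx : x ∈ X then hx.choose ∘ b else b
  have hf : ∀ g : M ≃[L] M, (∀ c ∈ C, g c = c) → f (g ∘ a) = g ∘ b := fun g hg => by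
    have hx : g ∘ a ∈ X := ⟨g, hg, rfl⟩
    obtain ⟨h1, h2⟩ := hx.choose_spec
    have h3 := hfix (g.symm.comp hx.choose)
      (fun c hc => by rw [Equiv.comp_apply, h1 c hc, symm_apply_of_fixes hg c hc])
      (funext fun i => by
        have := congrFun h2 i
        simp only [Function.comp_apply] at this
        simp [← this])
    simp only [f, dif_pos hx]
    funext i
    have := congrArg g (congrFun h3 i)
    simpa using this
  have hXdef : C.Definable L X := orbitOver_definable hM hC a
  have hYdef : C.Definable L Y := orbitOver_definable hM hC b
  have hsurj : IsDefinableSurjection L X Y f := by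
    refine ⟨?_, ((definable_iff_invariant hM hC).2 ?_).mono (Set.subset_univ C)⟩
    · ext y
      constructor
      · rintro ⟨_, ⟨g, hg, rfl⟩, rfl⟩
        exact ⟨g, hg, hf g hg⟩
      · rintro ⟨g, hg, rfl⟩
        exact ⟨_, ⟨g, hg, rfl⟩, hf g hg⟩
    · rintro g hg z ⟨⟨g', hg', hz⟩, hfz⟩
      have hgg : ∀ c ∈ C, (g.comp g') c = c := fun c hc => by simp [hg' c hc, hg c hc]
      have e : (g ∘ z) ∘ Sum.inl = (g.comp g') ∘ a := by
        rw [Function.comp_assoc, hz]; rfl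
      refine ⟨⟨g.comp g', hgg, e⟩, ?_⟩
      rw [e, hf _ hgg, Function.comp_assoc, ← hfz, hz, hf g' hg']
      rfl
  have hfib : ∀ g : M ≃[L] M, (∀ c ∈ C, g c = c) →
      fibre X f (g ∘ b) = translate g (orbitOver L (C ∪ Set.range b) a) := fun g hg => by
    ext x
    rw [mem_translate]
    constructor
    · rintro ⟨⟨g', hg', rfl⟩, hx⟩
      rw [hf g' hg'] at hx
      refine ⟨g.symm.comp g', ?_, rfl⟩
      rintro c (hc | ⟨j, rfl⟩)
      · rw [Equiv.comp_apply, hg' c hc, symm_apply_of_fixes hg c hc]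
      · have := congrFun hx j
        simp only [Function.comp_apply] at this
        simp [this]
    · rintro ⟨g', hg', hx⟩
      have hgg : ∀ c ∈ C, (g.comp g') c = c := fun c hc => by
        simp [hg' c (Or.inl hc), hg c hc]
      have e : x = (g.comp g') ∘ a := funext fun i => by
        have := congrFun hx i
        simp only [Function.comp_apply] at this
        simp [← this]
      refine ⟨⟨_, hgg, e⟩, ?_⟩
      rw [e, hf _ hgg]
      funext i
      simp [hg' (b i) (Or.inr ⟨i, rfl⟩)]
  have hval : ∀ y ∈ Y, h.val (fibre X f y) = h.val (orbitOver L (C ∪ Set.range b) a) := by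
    rintro _ ⟨g, hg, rfl⟩
    rw [hfib g hg, hh.val_translate]
    exact (orbitOver_definable hM (hC.union (Set.finite_range b)) a).mono (Set.subset_univ _)
  obtain ⟨D, hD, hX⟩ := hh.val_eq_leadingSum (hXdef.mono (Set.subset_univ _))
    (hYdef.mono (Set.subset_univ _)) hsurj
  have hD' : D = {h.val (orbitOver L (C ∪ Set.range b) a)} := by
    rw [← Finset.coe_inj, hD, Finset.coe_singleton]
    ext v
    constructor
    · rintro ⟨y, hy, rfl⟩
      exact hval y hy
    · rintro rfl
      exact ⟨b, mem_orbitOver_self C b, hval b (mem_orbitOver_self C b)⟩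
  have hlev : h.level X Y f (h.val (orbitOver L (C ∪ Set.range b) a)) = Y :=
    Set.ext fun y => ⟨fun hy => hy.1, fun hy => ⟨hy, hval y hy⟩⟩
  rw [hD', leadingSum_singleton, hlev, leadingMul_comm] at hX
  exact hX

theorem IsMS.isCMS {h : ValueFunction L M} (hh : IsMS h)
    (hM : Cardinal.Categorical (ℵ₀ : Cardinal.{w}) (L.completeTheory M)) : IsCMS h where
  cms1 n C a g hC := by
    rw [typeSet_eq_orbitOver hM (hC.image g), typeSet_eq_orbitOver hM hC, ← translate_orbitOver]
    exact hh.val_translate ((orbitOver_definable hM hC a).mono (Set.subset_univ _)) g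
  cms2 n C X k a hC _ hXU hdisj := by
    simp only [typeSet_eq_orbitOver hM hC] at hXU hdisj ⊢
    subst hXU
    exact eq_leadingSum_iff.1 (hh.val_iUnion hM hC _ (fun i => orbitOver_definable hM hC (a i))
      (fun i => ⟨a i, mem_orbitOver_self C (a i)⟩) hdisj)
  cms3 n C a hC ha := by
    rw [typeSet_eq_orbitOver hM hC]
    have := hh.val_of_finite ((orbitOver_definable hM hC a).mono (Set.subset_univ _))
      ((finite_orbitOver_iff hM hC).2 ha)
    exact ⟨congrArg Prod.fst this, congrArg Prod.snd this⟩
  cms4 n m C a b hC hb := by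
    rw [typeSet_eq_orbitOver hM hC, typeSet_eq_orbitOver hM hC,
      typeSet_eq_orbitOver hM (hC.union (Set.finite_range b))]
    have := hh.val_orbitOver hM hC a b hb
    exact ⟨congrArg Prod.fst this, congrArg Prod.snd this⟩

end

/-! ### From cMS to MS -/

section

variable {L : FirstOrder.Language.{u, v}} {M : Type w} [L.Structure M]

variable [Countable L.Symbols] [Countable M] [Infinite M]

theorem mem_of_definable_of_mem_orbitOver
    (hM : Cardinal.Categorical (ℵ₀ : Cardinal.{w}) (L.completeTheory M)) {n : ℕ} {C : Set M}
    (hC : C.Finite) {X : Set (Fin n → M)} (hX : C.Definable L X) {a x : Fin n → M} (ha : a ∈ X)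
    (hx : x ∈ orbitOver L C a) : x ∈ X := by
  obtain ⟨g, hg, rfl⟩ := hx
  exact (definable_iff_invariant hM hC).1 hX g hg a ha

theorem IsCMS.val_eq_leadingSum {h : ValueFunction L M} (hh : IsCMS h)
    (hM : Cardinal.Categorical (ℵ₀ : Cardinal.{w}) (L.completeTheory M)) {n : ℕ} {C : Set M}
    (hC : C.Finite) {X : Set (Fin (n + 1) → M)} (hX : C.Definable L X) :
    h.val X = leadingSum (orbits L C X) h.val := by
  classical
  let e := (orbits L C X).equivFin
  have hrep : ∀ i, ∃ a ∈ X, orbitOver L C a = (e.symm i).1 := fun i =>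
    (mem_orbits hM hC).1 (e.symm i).2
  choose a haX ha using hrep
  have hinj : Function.Injective fun i => orbitOver L C (a i) := fun i j hij => by
    simp only [ha] at hij
    exact e.symm.injective (Subtype.ext hij)
  have key := hh.cms2 n C X _ a hC hX (by
    ext x
    simp only [typeSet_eq_orbitOver hM hC, Set.mem_iUnion]
    constructor
    · intro hx
      refine ⟨e ⟨orbitOver L C x, (mem_orbits hM hC).2 ⟨x, hx, rfl⟩⟩, ?_⟩
      rw [ha, e.symm_apply_apply]
      exact mem_orbitOver_self C x
    · rintro ⟨i, hi⟩
      exact mem_of_definable_of_mem_orbitOver hM hC hX (haX i) hi) (by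
    intro i j hij
    simp only [typeSet_eq_orbitOver hM hC]
    refine Set.disjoint_left.2 fun x hi hj => hij (hinj ?_)
    exact (orbitOver_eq_of_mem hi).symm.trans (orbitOver_eq_of_mem hj))
  simp only [typeSet_eq_orbitOver hM hC] at key
  refine (eq_leadingSum_iff.2 key).trans ?_
  rw [← leadingSum_image (f := h.val) hinj.injOn]
  congr 1
  ext O
  simp only [Finset.mem_image, Finset.mem_univ, true_and, ha]
  exact ⟨by rintro ⟨i, rfl⟩; exact (e.symm i).2,
    fun hO => ⟨e ⟨O, hO⟩, by rw [e.symm_apply_apply]⟩⟩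

/-- The automorphism carries the orbits over `C` bijectively to those over `g '' C`, and cMS1
preserves the value of each. -/
theorem IsCMS.val_translate {h : ValueFunction L M} (hh : IsCMS h)
    (hM : Cardinal.Categorical (ℵ₀ : Cardinal.{w}) (L.completeTheory M)) {n : ℕ} {C : Set M}
    (hC : C.Finite) {X : Set (Fin (n + 1) → M)} (hX : C.Definable L X) (g : M ≃[L] M) :
    h.val (translate g X) = h.val X := by
  classical
  rw [hh.val_eq_leadingSum hM hC hX,
    hh.val_eq_leadingSum hM (hC.image g) (definable_translate hC hM hX g)]
  have : orbits L (g '' C) (translate g X) = (orbits L C X).image (translate g) := by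
    ext O
    simp only [Finset.mem_image, mem_orbits hM hC, mem_orbits hM (hC.image g)]
    constructor
    · rintro ⟨_, ⟨a, ha, rfl⟩, rfl⟩
      exact ⟨_, ⟨a, ha, rfl⟩, translate_orbitOver C a g⟩
    · rintro ⟨_, ⟨a, ha, rfl⟩, rfl⟩
      exact ⟨_, ⟨a, ha, rfl⟩, (translate_orbitOver C a g).symm⟩
  rw [this, leadingSum_image (translate_injective g).injOn]
  refine leadingSum_congr fun O hO => ?_
  obtain ⟨a, -, rfl⟩ := (mem_orbits hM hC).1 hO
  have := hh.cms1 n C a g hC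
  rwa [typeSet_eq_orbitOver hM (hC.image g), typeSet_eq_orbitOver hM hC,
    ← translate_orbitOver] at this

theorem IsCMS.val_orbitOver {h : ValueFunction L M} (hh : IsCMS h)
    (hM : Cardinal.Categorical (ℵ₀ : Cardinal.{w}) (L.completeTheory M)) {n m : ℕ} {C : Set M}
    (hC : C.Finite) (a : Fin (n + 1) → M) (b : Fin (m + 1) → M)
    (hb : ∀ i, b i ∈ dcl L (C ∪ Set.range a)) :
    h.val (orbitOver L C a) =
      leadingMul (h.val (orbitOver L C b)) (h.val (orbitOver L (C ∪ Set.range b) a)) := by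
  have := hh.cms4 n m C a b hC hb
  rw [typeSet_eq_orbitOver hM hC, typeSet_eq_orbitOver hM hC,
    typeSet_eq_orbitOver hM (hC.union (Set.finite_range b))] at this
  exact Prod.ext this.1 this.2

/-- The orbits inside a finite set are finite, hence algebraic over `C`. By cMS3 all have dimension
`0`, so the leading sum is an ordinary count. -/
theorem IsCMS.val_of_finite {h : ValueFunction L M} (hh : IsCMS h)
    (hM : Cardinal.Categorical (ℵ₀ : Cardinal.{w}) (L.completeTheory M)) {n : ℕ} {C : Set M}
    (hC : C.Finite) {X : Set (Fin (n + 1) → M)} (hX : C.Definable L X) (hfin : X.Finite) :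
    h.val X = (0, (X.ncard : ℝ)) := by
  classical
  have hO : ∀ O ∈ orbits L C X, h.val O = (0, (O.ncard : ℝ)) := fun O hO => by
    obtain ⟨a, ha, rfl⟩ := (mem_orbits hM hC).1 hO
    have := hh.cms3 n C a hC ((finite_orbitOver_iff hM hC).1
      (hfin.subset fun x hx => mem_of_definable_of_mem_orbitOver hM hC hX ha hx))
    rw [typeSet_eq_orbitOver hM hC] at this
    exact Prod.ext this.1 this.2
  have hcard : X.ncard = ∑ O ∈ orbits L C X, O.ncard := by
    rw [Set.ncard_eq_toFinset_card X hfin, Finset.card_eq_sum_card_fiberwise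
      (f := fun x => orbitOver L C x) (t := orbits L C X)
      (fun x hx => (mem_orbits hM hC).2 ⟨x, hfin.mem_toFinset.1 hx, rfl⟩)]
    refine Finset.sum_congr rfl fun O hO => ?_
    obtain ⟨a, ha, rfl⟩ := (mem_orbits hM hC).1 hO
    rw [← Set.ncard_coe_finset]
    congr 1
    ext x
    simp only [Finset.coe_filter, Set.Finite.mem_toFinset, Set.mem_ofPred_eq, mem_orbitOver_iff,
      and_iff_right_iff_imp]
    exact fun hx => mem_of_definable_of_mem_orbitOver hM hC hX ha (mem_orbitOver_iff.2 hx)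
  have hz : ((orbits L C X).sup fun _ => 0) = 0 :=
    Nat.eq_zero_of_le_zero (Finset.sup_le fun _ _ => le_rfl)
  rw [hh.val_eq_leadingSum hM hC hX, leadingSum_congr hO, hcard]
  simp [leadingSum, hz]

/-- A definable surjection over a finite set of parameters `C` is equivariant for `Aut(M/C)`. -/
theorem equivariant_of_definable_graph
    (hM : Cardinal.Categorical (ℵ₀ : Cardinal.{w}) (L.completeTheory M)) {n m : ℕ} {C : Set M}
    (hC : C.Finite) {X : Set (Fin n → M)} {f : (Fin n → M) → Fin m → M}
    (hf : C.Definable L {z : Fin n ⊕ Fin m → M | z ∘ Sum.inl ∈ X ∧ f (z ∘ Sum.inl) = z ∘ Sum.inr})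
    (g : M ≃[L] M) (hg : ∀ c ∈ C, g c = c) (x : Fin n → M) (hx : x ∈ X) :
    g ∘ x ∈ X ∧ f (g ∘ x) = g ∘ f x :=
  (definable_iff_invariant hM hC).1 hf g hg (Sum.elim x (f x)) ⟨hx, rfl⟩

/-- Fubini for a single orbit `P` in the target of a `C`-definable function. -/
theorem IsCMS.leadingMul_val_fibre {h : ValueFunction L M} (hh : IsCMS h)
    (hM : Cardinal.Categorical (ℵ₀ : Cardinal.{w}) (L.completeTheory M)) {n m : ℕ} {C : Set M}
    (hC : C.Finite) {X : Set (Fin (n + 1) → M)} {f : (Fin (n + 1) → M) → Fin (m + 1) → M}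
    (hX : C.Definable L X)
    (hf : ∀ g : M ≃[L] M, (∀ c ∈ C, g c = c) → ∀ x ∈ X, f (g ∘ x) = g ∘ f x)
    [DecidableEq (Set (Fin (m + 1) → M))]
    {b : Fin (m + 1) → M} (hb : b ∈ f '' X) :
    leadingMul (h.val (orbitOver L C b)) (h.val (fibre X f b)) =
      leadingSum ((orbits L C X).filter fun O => f '' O = orbitOver L C b) h.val := by
  classical
  have hCb : (C ∪ Set.range b).Finite := hC.union (Set.finite_range b)
  have hXinv := (definable_iff_invariant hM hC).1 hX
  have hfib : (C ∪ Set.range b).Definable L (fibre X f b) := by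
    refine (definable_iff_invariant hM hCb).2 ?_
    rintro g hg x ⟨hx, hfx⟩
    refine ⟨hXinv g (fun c hc => hg c (Or.inl hc)) x hx, ?_⟩
    rw [hf g (fun c hc => hg c (Or.inl hc)) x hx, hfx]
    exact funext fun i => hg _ (Or.inr ⟨i, rfl⟩)
  have horb : ∀ a ∈ X, f a = b → orbitOver L (C ∪ Set.range b) a =
      orbitOver L C a ∩ fibre X f b := by
    intro a ha hab
    ext x
    constructor
    · intro hx
      refine ⟨?_, mem_of_definable_of_mem_orbitOver hM hCb hfib ⟨ha, hab⟩ hx⟩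
      obtain ⟨g, hg, rfl⟩ := hx
      exact ⟨g, fun c hc => hg c (Or.inl hc), rfl⟩
    · rintro ⟨⟨g, hg, rfl⟩, -, hx⟩
      refine ⟨g, ?_, rfl⟩
      rw [hf g hg a ha, hab] at hx
      rintro c (hc | ⟨i, rfl⟩)
      · exact hg c hc
      · exact congrFun hx i
  have himg : ∀ a ∈ X, f '' orbitOver L C a = orbitOver L C (f a) := by
    intro a ha
    ext y
    constructor
    · rintro ⟨_, ⟨g, hg, rfl⟩, rfl⟩
      exact ⟨g, hg, hf g hg a ha⟩
    · rintro ⟨g, hg, rfl⟩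
      exact ⟨_, ⟨g, hg, rfl⟩, hf g hg a ha⟩
  let I := (orbits L C X).filter fun O => f '' O = orbitOver L C b
  have hI : ∀ O ∈ I, ∃ a ∈ X, f a = b ∧ orbitOver L C a = O := by
    intro O hO
    obtain ⟨hO, hOb⟩ := Finset.mem_filter.1 hO
    obtain ⟨a, ha, rfl⟩ := (mem_orbits hM hC).1 hO
    obtain ⟨a', ha', hab⟩ := hOb ▸ mem_orbitOver_self (L := L) C b
    exact ⟨a', mem_of_definable_of_mem_orbitOver hM hC hX ha ha', hab, orbitOver_eq_of_mem ha'⟩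
  have hIne : I.Nonempty := by
    obtain ⟨a, ha, rfl⟩ := hb
    exact ⟨_, Finset.mem_filter.2 ⟨(mem_orbits hM hC).2 ⟨a, ha, rfl⟩, himg a ha⟩⟩
  -- Each orbit over `C` mapping onto the orbit of `b` meets the fibre in exactly one orbit over `C`
  -- and `b`, so cMS4 can be applied term by term.
  have hfiborb : orbits L (C ∪ Set.range b) (fibre X f b) = I.image (· ∩ fibre X f b) := by
    ext O
    simp only [Finset.mem_image, mem_orbits hM hCb]
    constructor
    · rintro ⟨a, ⟨ha, hab⟩, rfl⟩
      refine ⟨orbitOver L C a, Finset.mem_filter.2 ⟨(mem_orbits hM hC).2 ⟨a, ha, rfl⟩, ?_⟩,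
        (horb a ha hab).symm⟩
      rw [himg a ha, hab]
    · rintro ⟨O, hO, rfl⟩
      obtain ⟨a, ha, hab, rfl⟩ := hI O hO
      exact ⟨a, ⟨ha, hab⟩, horb a ha hab⟩
  have hinj : Set.InjOn (· ∩ fibre X f b) (I : Set (Set (Fin (n + 1) → M))) := by
    intro O hO O' hO' heq
    obtain ⟨a, ha, hab, rfl⟩ := hI O hO
    obtain ⟨a', ha', hab', rfl⟩ := hI O' hO'
    have : a ∈ orbitOver L C a' ∩ fibre X f b :=
      (Set.ext_iff.1 heq a).1 ⟨mem_orbitOver_self C a, ha, hab⟩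
    exact orbitOver_eq_of_mem this.1
  rw [hh.val_eq_leadingSum hM hCb hfib, hfiborb, leadingSum_image hinj, ← leadingSum_mul hIne]
  refine leadingSum_congr fun O hO => ?_
  obtain ⟨a, ha, hab, rfl⟩ := hI O hO
  rw [← horb a ha hab]
  refine (hh.val_orbitOver hM hC a b fun i => ?_).symm
  refine (mem_dcl_iff hM (hC.union (Set.finite_range a))).2 fun g hg => ?_
  have hga : g ∘ a = a := funext fun j => hg _ (Or.inr ⟨j, rfl⟩)
  have := hf g (fun c hc => hg c (Or.inl hc)) a ha
  rw [hga, hab] at this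
  exact (congrFun this i).symm

/-- Over a finite `C` defining all the data, fibre values are constant on the orbits in `Y`. Both
sides then become the same sum over the orbits in `X`. -/
theorem IsCMS.fubini {h : ValueFunction L M} (hh : IsCMS h)
    (hM : Cardinal.Categorical (ℵ₀ : Cardinal.{w}) (L.completeTheory M)) {n m : ℕ}
    {X : Set (Fin (n + 1) → M)} {Y : Set (Fin (m + 1) → M)} {f : (Fin (n + 1) → M) → Fin (m + 1) → M}
    (hX : (Set.univ : Set M).Definable L X) (hY : (Set.univ : Set M).Definable L Y)
    (hf : IsDefinableSurjection L X Y f) :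
    ∃ D : Finset (ℕ × ℝ), (D : Set (ℕ × ℝ)) = (fun b => h.val (fibre X f b)) '' Y ∧
      (∀ v ∈ D, (Set.univ : Set M).Definable L (h.level X Y f v)) ∧
      h.val X = leadingSum D fun v => leadingMul v (h.val (h.level X Y f v)) := by
  classical
  obtain ⟨C₁, -, hC₁⟩ := Set.definable_iff_finitely_definable.1 hX
  obtain ⟨C₂, -, hC₂⟩ := Set.definable_iff_finitely_definable.1 hY
  obtain ⟨C₃, -, hC₃⟩ := Set.definable_iff_finitely_definable.1 hf.2
  let C : Set M := C₁ ∪ C₂ ∪ C₃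
  have hC : C.Finite := (C₁.finite_toSet.union C₂.finite_toSet).union C₃.finite_toSet
  replace hX : C.Definable L X := hC₁.mono fun c hc => Or.inl (Or.inl hc)
  replace hY : C.Definable L Y := hC₂.mono fun c hc => Or.inl (Or.inr hc)
  have hequi := equivariant_of_definable_graph hM hC (hC₃.mono fun c hc => Or.inr hc)
  have hfeq : ∀ g : M ≃[L] M, (∀ c ∈ C, g c = c) → ∀ x ∈ X, f (g ∘ x) = g ∘ f x :=
    fun g hg x hx => (hequi g hg x hx).2
  have hfib : ∀ g : M ≃[L] M, (∀ c ∈ C, g c = c) → ∀ b, h.val (fibre X f (g ∘ b)) =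
      h.val (fibre X f b) := by
    intro g hg b
    have hdef : (C ∪ Set.range b).Definable L (fibre X f b) := by
      refine (definable_iff_invariant hM (hC.union (Set.finite_range b))).2 ?_
      rintro g hg x ⟨hx, hfx⟩
      obtain ⟨h1, h2⟩ := hequi g (fun c hc => hg c (Or.inl hc)) x hx
      refine ⟨h1, ?_⟩
      rw [h2, hfx]
      exact funext fun i => hg _ (Or.inr ⟨i, rfl⟩)
    rw [← hh.val_translate hM (hC.union (Set.finite_range b)) hdef g]
    congr 1
    ext x
    rw [mem_translate]
    constructor
    · rintro ⟨hx, hfx⟩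
      obtain ⟨h1, h2⟩ := hequi g.symm (symm_apply_of_fixes hg) x hx
      refine ⟨h1, ?_⟩
      rw [h2, hfx]
      exact funext fun i => by simp
    · rintro ⟨hx, hfx⟩
      obtain ⟨h1, h2⟩ := hequi g hg _ hx
      have e : g ∘ (g.symm ∘ x) = x := funext fun i => by simp
      rw [e] at h1 h2
      exact ⟨h1, by rw [h2, hfx]⟩
  have hlevdef : ∀ v, C.Definable L (h.level X Y f v) := fun v => by
    refine (definable_iff_invariant hM hC).2 ?_
    rintro g hg b ⟨hb, hbv⟩
    exact ⟨(definable_iff_invariant hM hC).1 hY g hg b hb, (hfib g hg b).trans hbv⟩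
  have hrep : ∀ P : Set (Fin (m + 1) → M), ∃ b, P ∈ orbits L C Y → b ∈ Y ∧ orbitOver L C b = P := by
    intro P
    by_cases hP : P ∈ orbits L C Y
    · obtain ⟨b, hb⟩ := (mem_orbits hM hC).1 hP
      exact ⟨b, fun _ => hb⟩
    · exact ⟨fun _ => Classical.arbitrary M, fun h => absurd h hP⟩
  choose β hβ using hrep
  let val : Set (Fin (m + 1) → M) → ℕ × ℝ := fun P => h.val (fibre X f (β P))
  have hval : ∀ b ∈ Y, val (orbitOver L C b) = h.val (fibre X f b) := by
    intro b hb
    obtain ⟨-, h2⟩ := hβ _ ((mem_orbits hM hC).2 ⟨b, hb, rfl⟩)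
    obtain ⟨g, hg, h3⟩ := mem_orbitOver_iff.2 h2
    simp only [val]
    rw [h3, hfib g hg b]
  have hmaps : ∀ O ∈ orbits L C X, f '' O ∈ orbits L C Y := by
    intro O hO
    obtain ⟨a, ha, rfl⟩ := (mem_orbits hM hC).1 hO
    refine (mem_orbits hM hC).2 ⟨f a, hf.1 ▸ ⟨a, ha, rfl⟩, ?_⟩
    ext y
    constructor
    · rintro ⟨g, hg, rfl⟩
      exact ⟨_, ⟨g, hg, rfl⟩, hfeq g hg a ha⟩
    · rintro ⟨_, ⟨g, hg, rfl⟩, rfl⟩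
      exact ⟨g, hg, hfeq g hg a ha⟩
  let D : Finset (ℕ × ℝ) := (orbits L C Y).image val
  refine ⟨D, ?_, fun v _ => (hlevdef v).mono (Set.subset_univ _), ?_⟩
  · ext v
    simp only [D, Finset.coe_image, Set.mem_image, Finset.mem_coe, mem_orbits hM hC]
    constructor
    · rintro ⟨_, ⟨b, hb, rfl⟩, rfl⟩
      exact ⟨b, hb, (hval b hb).symm⟩
    · rintro ⟨b, hb, rfl⟩
      exact ⟨_, ⟨b, hb, rfl⟩, hval b hb⟩
  -- The orbits of `X` are grouped by their image `P` in `Y`; the orbits `P` are then grouped by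
  -- fibre value `v`, which recovers the level sets.
  · rw [hh.val_eq_leadingSum hM hC hX, ← leadingSum_fiberwise hmaps]
    have h1 : ∀ P ∈ orbits L C Y, leadingSum ((orbits L C X).filter fun O => f '' O = P) h.val =
        leadingMul (val P) (h.val P) := by
      intro P hP
      obtain ⟨hb, hbP⟩ := hβ P hP
      have := hh.leadingMul_val_fibre hM hC hX hfeq (b := β P) (hf.1.symm ▸ hb)
      rw [hbP] at this
      rw [← this, leadingMul_comm]
    rw [leadingSum_congr h1, ← leadingSum_fiberwise (t := D) (π := val)
      (fun P hP => Finset.mem_image_of_mem _ hP)]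
    refine leadingSum_congr fun v hv => ?_
    have hlev : orbits L C (h.level X Y f v) = (orbits L C Y).filter fun P => val P = v := by
      ext P
      simp only [Finset.mem_filter, mem_orbits hM hC]
      constructor
      · rintro ⟨b, ⟨hb, hbv⟩, rfl⟩
        exact ⟨⟨b, hb, rfl⟩, (hval b hb).trans hbv⟩
      · rintro ⟨⟨b, hb, rfl⟩, hbv⟩
        exact ⟨b, ⟨hb, (hval b hb).symm.trans hbv⟩, rfl⟩
    obtain ⟨P, hP, hPv⟩ := Finset.mem_image.1 hv
    rw [hh.val_eq_leadingSum hM hC (hlevdef v), hlev,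
      ← leadingSum_mul ⟨P, Finset.mem_filter.2 ⟨hP, hPv⟩⟩]
    exact leadingSum_congr fun P hP => by rw [(Finset.mem_filter.1 hP).2]

/-- Invariance of `h` gives MS1, as there are finitely many types of parameters, and MS3, as
invariant sets are `∅`-definable. -/
theorem IsCMS.isMS {h : ValueFunction L M} (hh : IsCMS h)
    (hM : Cardinal.Categorical (ℵ₀ : Cardinal.{w}) (L.completeTheory M)) : IsMS h where
  ms1 n m φ := by
    obtain ⟨s, hs⟩ := exists_finset_sameType hM (Fin m)
    refine ⟨_, s.finite_toSet.image fun a => h.val (solutionSet φ a), fun a => ?_⟩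
    obtain ⟨a₀, ha₀, hsame⟩ := hs a
    obtain ⟨g, rfl⟩ := exists_equiv_of_sameType hM hsame
    refine ⟨a₀, ha₀, ?_⟩
    rw [← translate_solutionSet]
    exact (hh.val_translate hM (Set.finite_range a₀) (solutionSet_definable φ a₀) g).symm
  ms2 n m φ a hfin := hh.val_of_finite hM (Set.finite_range a) (solutionSet_definable φ a) hfin
  ms3 n m φ v := by
    refine definable_of_invariant hM fun g a ha => ?_
    simp only [Set.mem_ofPred_eq] at ha ⊢
    rw [← translate_solutionSet,
      hh.val_translate hM (Set.finite_range a) (solutionSet_definable φ a) g, ha]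
  ms4 n m X Y f hX hY hf := by
    obtain ⟨D, hD, hlev, hval⟩ := hh.fubini hM hX hY hf
    obtain ⟨h1, h2⟩ := eq_leadingSum_iff.1 hval
    exact ⟨D, hD, hlev, h1, h2⟩

end

end MSMeasure

end

theorem mainTheorem2 (L : FirstOrder.Language.{u, v}) [Countable L.Symbols]
    (M : Type w) [L.Structure M] [Countable M] [Infinite M]
    (hM : Cardinal.Categorical (ℵ₀ : Cardinal.{w}) (L.completeTheory M)) :
    MSMeasure.IsMSMeasurable L M ↔
      ∃ h : MSMeasure.ValueFunction L M, MSMeasure.IsCMS h :=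
  ⟨fun ⟨_, h, hh⟩ => ⟨h, hh.isCMS hM⟩, fun ⟨h, hh⟩ => ⟨inferInstance, h, hh.isMS hM⟩⟩
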